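/- Let $0<q<1$ and $[k]=\frac{1-q^k}{1-q}$. For $r\ge 0$ and $s\in\mathbb{C}^r$ write $\sigma_j=s_1+\dots+s_j$. The $q$-multiple zeta function of depth $r$ is $$\zeta_q(s_1,\dots,s_r)=\sum_{k_1>\dots>k_r\ge 1}\frac{q^{k_1s_1+\dots+k_rs_r}}{[k_1]^{s_1}\cdots[k_r]^{s_r}}$$ on the domain $\mathrm{Re}\,\sigma_j>0$ ($1\le j\le r$), where the series converges absolutely; in depth $0$ it is the constant $1$. It extends to a meromorphic function on $\mathbb{C}^r$, again denoted $\zeta_q$, which is holomorphic off the hyperplanes $\sigma_j\in\mathbb{Z}_{\le 0}+\frac{2\pi i}{\log q}\mathbb{Z}$, $1\le j\le r$. Put $q_m(t)=q^{-(t+m)}-1$ and $(t)_n=t(t+1)\cdots(t+n-1)$. Let $M(t)$ and $N(t)$ be the infinite upper triangular matrices, with rows and columns indexed by $0,1,2,\dots$, whose entries are $$M(t)_{m,m}=1,\qquad M(t)_{m,n}=\frac{(-1)^{n-m-1}(t+m)_{n-m}}{(n-m)!\,q_m(t)}\quad(n>m),\qquad N(t)_{m,n}=\frac{(-1)^{n-m}(t+m)_{n-m}}{(n-m)!\,q_m(t)}\quad(n\ge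 m),$$ and put $H(t)=M(t)^{-1}N(t)$. Here $(M(t)^{-1})_{m,n}=(-1)^{n-m}D_{1,n-m+1}(t+m)$ for $n\ge m$, where $D_{1,n}(t)=\det\big(M(t)_{a,b+1}\big)_{0\le a,b\le n-2}$ (and $D_{1,1}=1$). Define $\mathcal{L}_n(t)$ by $D_{1,n}(t)=t(t+1)\cdots(t+n-2)\,\mathcal{L}_n(t)$, so that $\mathcal L_1=1$. **Theorem.** Let $2\le j\le r$ and $k\ge 0$. Along the hyperplane $\mathcal{H}_{j,k}:\ s_1+\dots+s_j=-k$ the function $\zeta_q(s_1,\dots,s_r)$ has at most a simple pole, and its residue there is the restriction to $\mathcal{H}_{j,k}$ of $$\sum_{s=0}^{k}-(k-s)!\;\mathcal{L}_{k-s+1}\big(-(k-s)\big)\,\frac{\zeta_q(s_{j+1},\dots,s_r)}{\log q}\times\Big((0,s)\text{-th entry of }H(s_1)\,H(s_1+s_2)\cdots H(s_1+\dots+s_{j-1})\Big).$$ That is, near every point of $\mathcal{H}_{j,k}$ that lies on no hyperplane $\sigma_i\in\mathbb{Z}_{\le 0}+\frac{2\pi i}{\log q}\mathbb{Z}$ with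 $1\le i\le r$, $i\neq j$, the function $(s_1+\dots+s_j+k)\,\zeta_q(s_1,\dots,s_r)$ extends holomorphically across $\mathcal{H}_{j,k}$, and its value at that point is given by the displayed sum. -/

import Mathlib

open Topology Filter

noncomputable section

namespace QMZV

/-- The `q`-analogue `[k]_q = (1 - q ^ k) / (1 - q)` of the positive integer `k`. -/
def qNat (q : ℝ) (k : ℕ) : ℝ := (1 - q ^ k) / (1 - q)

/-- The index set `k_1 > ⋯ > k_r ≥ 1` of the defining series. -/
def Idx (r : ℕ) : Type := {k : Fin r → ℕ // StrictAnti k ∧ ∀ i, 1 ≤ k i}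

/-- The summand `q ^ (k_1 s_1 + ⋯ + k_r s_r) / ([k_1] ^ s_1 ⋯ [k_r] ^ s_r)`. -/
def term (q : ℝ) {r : ℕ} (s : Fin r → ℂ) (k : Idx r) : ℂ :=
  (q : ℂ) ^ (∑ i, (k.1 i : ℂ) * s i) / ∏ i, (qNat q (k.1 i) : ℂ) ^ (s i)

/-- The partial sum `s_1 + ⋯ + s_j`. -/
def psum {r : ℕ} (s : Fin r → ℂ) (j : ℕ) : ℂ :=
  ∑ i ∈ Finset.univ.filter (fun i : Fin r => (i : ℕ) < j), s i

/-- The domain `U_r`: `Re (s_1 + ⋯ + s_j) > 0` for `j = 1, …, r`. -/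
def domU (r : ℕ) : Set (Fin r → ℂ) :=
  {s | ∀ j : ℕ, 1 ≤ j → j ≤ r → 0 < (psum s j).re}

/-- `z ∈ ℤ_{≤ 0} + (2 π i / log q) ℤ`. -/
def IsPole (q : ℝ) (z : ℂ) : Prop :=
  ∃ (a : ℕ) (b : ℤ), z = -(a : ℂ) + 2 * (Real.pi : ℂ) * Complex.I / (Real.log q : ℂ) * (b : ℂ)

/-- The locally finite union of hyperplanes `s_1 + ⋯ + s_j ∈ ℤ_{≤ 0} + (2 π i / log q) ℤ`,
`1 ≤ j ≤ r`. -/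
def polarSet (q : ℝ) (r : ℕ) : Set (Fin r → ℂ) :=
  {s | ∃ j : ℕ, 1 ≤ j ∧ j ≤ r ∧ IsPole q (psum s j)}

/-- `Z` is the meromorphic continuation to `ℂ ^ r` of the `q`-multiple zeta function of depth `r`:
it is the sum of the defining series on `U_r`, it is holomorphic off the polar hyperplanes, and
near every point of `ℂ ^ r` it is a quotient of holomorphic functions. As the complement of the
polar set is open, connected and dense, and contains `U_r`, the values of `Z` off the polar set are
determined by these properties; its values on the polar set carry no meaning. In depth `0` the
series has one summand, the empty product `1`. -/
structure IsContinuation (q : ℝ) (r : ℕ) (Z : (Fin r → ℂ) → ℂ) : Prop where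
  hasSum : ∀ s ∈ domU r, HasSum (term q s) (Z s)
  analytic : ∀ s, s ∉ polarSet q r → AnalyticAt ℂ Z s
  meromorphic : ∀ p, ∃ g h : (Fin r → ℂ) → ℂ, AnalyticAt ℂ g p ∧ AnalyticAt ℂ h p ∧
    (∃ᶠ s in 𝓝 p, h s ≠ 0) ∧ ∀ᶠ s in 𝓝 p, s ∉ polarSet q r → h s * Z s = g s

/-- The hyperplane `s_1 + ⋯ + s_j = -k`. -/
def hyperplane (r j k : ℕ) : Set (Fin r → ℂ) := {s | psum s j = -(k : ℂ)}

/-- A function `Z` that is holomorphic off the polar set has at most a simple pole along the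
hyperplane `s_1 + ⋯ + s_j = -k`, and its residue there is the restriction of `F` to the hyperplane:
at every point `p` of the hyperplane off the other polar hyperplanes, the function
`(s_1 + ⋯ + s_j + k) Z(s)` extends holomorphically to a neighbourhood of `p`, and the extension has
the value `F p` at `p`. -/
def HasResidueAlong (q : ℝ) {r : ℕ} (Z : (Fin r → ℂ) → ℂ) (j k : ℕ) (F : (Fin r → ℂ) → ℂ) : Prop :=
  ∀ p ∈ hyperplane r j k,
    (∀ i : ℕ, 1 ≤ i → i ≤ r → i ≠ j → ¬ IsPole q (psum p i)) →
    ∃ g : (Fin r → ℂ) → ℂ, AnalyticAt ℂ g p ∧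
      (∀ᶠ s in 𝓝 p, s ∉ polarSet q r → g s = (psum s j + (k : ℂ)) * Z s) ∧ g p = F p

/-- The tail `(s_{j+1}, …, s_r)`. -/
def tail {r : ℕ} (s : Fin r → ℂ) (j : ℕ) : Fin (r - j) → ℂ :=
  fun i => s ⟨j + i, by have := i.2; omega⟩

/-- `t (t + 1) ⋯ (t + n - 1)`. -/
def rising (t : ℂ) (n : ℕ) : ℂ := ∏ i ∈ Finset.range n, (t + (i : ℂ))

/-- `q_i(t) = q ^ (-(t + i)) - 1`. -/
def qDen (q : ℝ) (i : ℕ) (t : ℂ) : ℂ := (q : ℂ) ^ (-(t + (i : ℂ))) - 1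

/-- The infinite upper triangular matrix `M(t)`, rows and columns indexed from `0`. -/
def matM (q : ℝ) (t : ℂ) : Matrix ℕ ℕ ℂ := fun m n =>
  if n < m then 0
  else if n = m then 1
  else (-1) ^ (n - m - 1) * rising (t + (m : ℂ)) (n - m) /
    (((n - m).factorial : ℂ) * qDen q m t)

/-- The infinite upper triangular matrix `N(t)`, rows and columns indexed from `0`. -/
def matN (q : ℝ) (t : ℂ) : Matrix ℕ ℕ ℂ := fun m n =>
  if n < m then 0
  else (-1) ^ (n - m) * rising (t + (m : ℂ)) (n - m) / (((n - m).factorial : ℂ) * qDen q m t)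

/-- The determinant `D_{1,n}(t)`, of size `n - 1`, formed by the first `n - 1` rows of `M(t)` and
its columns with (zero-based) indices `1, …, n - 1`. -/
def detD (q : ℝ) (n : ℕ) (t : ℂ) : ℂ :=
  Matrix.det (Matrix.of fun a b : Fin (n - 1) => matM q t (a : ℕ) ((b : ℕ) + 1))

/-- `𝓛_n(t)`, defined by `D_{1,n}(t) = t (t + 1) ⋯ (t + n - 2) 𝓛_n(t)`. It is used only at points
`t` where the rising product does not vanish. -/
def calL (q : ℝ) (n : ℕ) (t : ℂ) : ℂ := detD q n t / rising t (n - 1)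

/-- The product of two infinite upper triangular matrices: all entries are finite sums. -/
def triMul (A B : Matrix ℕ ℕ ℂ) : Matrix ℕ ℕ ℂ := fun m n => ∑ l ∈ Finset.Icc m n, A m l * B l n

/-- The inverse of the infinite unitriangular matrix `M(t)`: its entry in row `m` and column `n`,
`m ≤ n`, is `(-1) ^ (n - m) D_{1, n - m + 1}(t + m)`. -/
def matMInv (q : ℝ) (t : ℂ) : Matrix ℕ ℕ ℂ := fun m n =>
  if n < m then 0 else (-1) ^ (n - m) * detD q (n - m + 1) (t + (m : ℂ))

/-- `H(t) = M(t)⁻¹ N(t)`. -/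
def matH (q : ℝ) (t : ℂ) : Matrix ℕ ℕ ℂ := triMul (matMInv q t) (matN q t)

/-- The ordered product `H(s_1) H(s_1 + s_2) ⋯ H(s_1 + ⋯ + s_n)`. -/
def prodH (q : ℝ) {r : ℕ} (s : Fin r → ℂ) : ℕ → Matrix ℕ ℕ ℂ
  | 0 => 1
  | n + 1 => triMul (prodH q s n) (matH q (psum s (n + 1)))

end QMZV

end

open Topology Filter

noncomputable section

namespace QMZV

open scoped BoundedContinuousFunction

/-! ### Rising factorials and the coefficients of `(1 - x) ^ (-t)` -/

/-! Write `σ_l = s_1 + ⋯ + s_l` and `N_l = n_1 + ⋯ + n_l`. Expanding every `(1 - q ^ k_i) ^ (-s_i)`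
by the binomial series and then summing the geometric series in the gaps of `k_1 > ⋯ > k_r` gives,
on `domU`, `(1 - q) ^ σ_r` times the sum over `n ∈ ℕ ^ r` of `∏ rbinom (s_i) (n_i) / ∏ (q ^ (-(σ_l +
N_l)) - 1)` (`zetaCont_hasSum`). The denominators grow like `q ^ (-N_l)`, so this series converges
far beyond `domU`. Multiplied by the denominators that may vanish near a point it is holomorphic
there (`analyticAt_regSum`), so it is the continuation; any other one agrees with it off the polar
set (`IsContinuation.eq_of_notMem`).

At `σ_j = -k` only the terms with `N_j = k` are singular, and `q ^ (-z) - 1 ~ -z log q` at `0`. In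
these terms `σ_l + N_l` for `l > j` involves the tail variables alone, so the sum factors
(`regSum_eq_of_mem_hyperplane`). The residue is `-(1 - q) ^ (-k) / log q` times the zeta value of
the tail times a finite sum over `n_1 + ⋯ + n_j = k`, which is `iterSum`.

It remains to identify that finite sum with the matrix expression. The matrix `P(t)` of binomial
coefficients satisfies `H(t) P(t) = P(t) Δ(t)` with `Δ(t)` diagonal with entries `1 / (q ^ (-(t +
n)) - 1)` (`matH_triMul_matP`), and by Vandermonde, convolving its rows with `rbinom x` turns `P(t)`
into `P(t + x)`. Hence row `0` of `H(σ_1) ⋯ H(σ_{j-1}) P(σ_j)` is the iterated sum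
(`sum_prodH_mul_matP`). At `σ_j = -k` column `k` of `P(-k)` consists, up to the factor `(1 - q) ^
k`, of the numbers `(k - s)! 𝓛_{k-s+1}(-(k - s))`, by Cramer's rule (`detD_neg_natCast`). -/

/-- `q ^ (-z) - 1`. -/
def expDen (q : ℝ) (z : ℂ) : ℂ := (q : ℂ) ^ (-z) - 1

/-- The coefficient `t (t + 1) ⋯ (t + n - 1) / n!` of `x ^ n` in `(1 - x) ^ (-t)`. -/
def rbinom (t : ℂ) (n : ℕ) : ℂ := rising t n / (n.factorial : ℂ)

lemma qDen_eq (q : ℝ) (i : ℕ) (t : ℂ) : qDen q i t = expDen q (t + i) := rfl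

lemma rising_succ (t : ℂ) (n : ℕ) : rising t (n + 1) = rising t n * (t + n) := by
  simp [rising, Finset.prod_range_succ]

lemma rising_add (t : ℂ) (m n : ℕ) : rising t (m + n) = rising t m * rising (t + m) n := by
  simp [rising, Finset.prod_range_add, add_assoc]

lemma rising_neg_self (m : ℕ) : rising (-(m : ℂ)) m = (-1) ^ m * (m.factorial : ℂ) := by
  -- The complementary factorial absorbs the missing factors of a partial product, so the induction
  -- on `n` closes; `n = m` is the claim.
  have h : ∀ n ≤ m, rising (-(m : ℂ)) n * ((m - n).factorial : ℂ) =
      (-1) ^ n * (m.factorial : ℂ) := by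
    intro n
    induction n with
    | zero => simp [rising]
    | succ n ih =>
      intro hn
      have h1 := ih (by omega)
      obtain ⟨d, rfl⟩ := Nat.exists_eq_add_of_le hn
      rw [show n + 1 + d - n = d + 1 by omega, Nat.factorial_succ] at h1
      rw [show n + 1 + d - (n + 1) = d by omega, rising_succ, pow_succ]
      push_cast at h1 ⊢
      linear_combination -h1
  simpa using h m le_rfl

@[simp] lemma rbinom_zero (t : ℂ) : rbinom t 0 = 1 := by simp [rbinom, rising]

lemma rbinom_neg_self (m : ℕ) : rbinom (-(m : ℂ)) m = (-1) ^ m := by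
  rw [rbinom, rising_neg_self]
  field_simp [Nat.cast_ne_zero.mpr m.factorial_ne_zero]

lemma rbinom_eq_multichoose (t : ℂ) (n : ℕ) : rbinom t n = Ring.multichoose t n := by
  have h : (n.factorial : ℂ) * Ring.multichoose t n = rising t n := by
    rw [← nsmul_eq_mul, Ring.factorial_nsmul_multichoose_eq_ascPochhammer,
      Polynomial.ascPochhammer_smeval_eq_eval]
    induction n with
    | zero => simp [rising]
    | succ n ih => rw [ascPochhammer_succ_eval, ih, rising_succ]
  rw [rbinom, ← h]
  field_simp [Nat.cast_ne_zero.mpr n.factorial_ne_zero]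

lemma rbinom_eq_choose_neg (t : ℂ) (n : ℕ) : rbinom t n = (-1) ^ n * Ring.choose (-t) n := by
  rw [rbinom_eq_multichoose, Ring.choose_neg']
  rcases Nat.even_or_odd n with h | h
  · simp [h.neg_one_pow, Int.negOnePow_even _ ((Int.even_coe_nat n).2 h)]
  · simp [h.neg_one_pow, Int.negOnePow_odd _ ((Int.odd_coe_nat n).2 h)]

/-- The Vandermonde identity for rising factorials. -/
lemma rbinom_add (x y : ℂ) (n : ℕ) :
    rbinom (x + y) n = ∑ ij ∈ Finset.HasAntidiagonal.antidiagonal n, rbinom x ij.1 * rbinom y ij.2 := by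
  rw [rbinom_eq_choose_neg, neg_add, Ring.add_choose_eq n (Commute.all _ _), Finset.mul_sum]
  refine Finset.sum_congr rfl fun ij h => ?_
  rw [rbinom_eq_choose_neg, rbinom_eq_choose_neg, ← Finset.HasAntidiagonal.mem_antidiagonal.1 h, pow_add]
  ring

lemma rbinom_mul_rbinom (t : ℂ) (i n : ℕ) :
    rbinom t i * rbinom (t + i) n = ((i + n).choose i : ℂ) * rbinom t (i + n) := by
  have h : ((i + n).choose i : ℂ) * (i.factorial : ℂ) * (n.factorial : ℂ) =
      ((i + n).factorial : ℂ) := by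
    have := Nat.add_choose_mul_factorial_mul_factorial i n
    rw [← Nat.choose_symm_add] at this
    exact_mod_cast this
  have h1 := Nat.cast_ne_zero (R := ℂ).mpr i.factorial_ne_zero
  have h2 := Nat.cast_ne_zero (R := ℂ).mpr n.factorial_ne_zero
  have h3 := Nat.cast_ne_zero (R := ℂ).mpr (i + n).factorial_ne_zero
  rw [rbinom, rbinom, rbinom, rising_add]
  field_simp
  rw [← h]
  ring

/-! ### Infinite triangular matrices -/

lemma triMul_assoc (A B C : Matrix ℕ ℕ ℂ) :
    triMul (triMul A B) C = triMul A (triMul B C) := by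
  funext m n
  simp only [triMul, Finset.sum_mul, Finset.mul_sum]
  rw [Finset.sum_comm' (t' := Finset.Icc m n) (s' := fun k => Finset.Icc k n)]
  · exact Finset.sum_congr rfl fun _ _ => Finset.sum_congr rfl fun _ _ => mul_assoc _ _ _
  · intro x y
    simp only [Finset.mem_Icc]
    omega

/-- The row vector `v` with `v A = (1, 0, 0, …)`, for a unitriangular matrix `A`. -/
def firstRowInv (A : Matrix ℕ ℕ ℂ) : ℕ → ℂ
  | n => (if n = 0 then 1 else 0) - ∑ l : Fin n, firstRowInv A l * A l n
decreasing_by exact l.2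

lemma sum_firstRowInv_mul {A : Matrix ℕ ℕ ℂ} (hA : ∀ m, A m m = 1) (n : ℕ) :
    ∑ l ∈ Finset.range (n + 1), firstRowInv A l * A l n = if n = 0 then 1 else 0 := by
  rw [Finset.sum_range_succ, hA, mul_one, firstRowInv, ← Fin.sum_univ_eq_sum_range
    (fun l => firstRowInv A l * A l n)]
  ring

lemma det_truncation {A : Matrix ℕ ℕ ℂ} (hA : ∀ m, A m m = 1) (hA' : ∀ m n, n < m → A m n = 0)
    (n : ℕ) : (Matrix.of fun a b : Fin n => A a b).det = 1 := by
  rw [Matrix.det_of_isUpperTriangular]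
  · simp [hA]
  · intro i j hij
    exact hA' _ _ hij

/-- This cofactor deletes the last row and the first column, which leaves exactly the shape of the
determinant in `detD`. -/
lemma adjugate_truncation (A : Matrix ℕ ℕ ℂ) (n : ℕ) :
    (Matrix.of fun a b : Fin (n + 1) => A a b).adjugate 0 (Fin.last n) =
      (-1) ^ n * (Matrix.of fun a b : Fin n => A a (b + 1)).det := by
  rw [Matrix.adjugate_fin_succ_eq_det_submatrix]
  simp only [Fin.val_last, Fin.val_zero, add_zero]
  congr 2
  ext a b
  simp

/-- Cramer's rule for the first row of the inverse of a unitriangular matrix. -/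
lemma firstRowInv_eq_det {A : Matrix ℕ ℕ ℂ} (hA : ∀ m, A m m = 1)
    (hA' : ∀ m n, n < m → A m n = 0) (n : ℕ) :
    firstRowInv A n = (-1) ^ n * (Matrix.of fun a b : Fin n => A a (b + 1)).det := by
  set T : Matrix (Fin (n + 1)) (Fin (n + 1)) ℂ := Matrix.of fun a b => A a b with hT
  set v : Fin (n + 1) → ℂ := fun a => firstRowInv A a with hv
  have h1 : Matrix.vecMul v T = Pi.single 0 1 := by
    funext b
    have h2 := sum_firstRowInv_mul hA b
    have h3 : ∑ l ∈ Finset.range (n + 1), firstRowInv A l * A l b =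
        ∑ l ∈ Finset.range ((b : ℕ) + 1), firstRowInv A l * A l b := by
      symm
      refine Finset.sum_subset (fun x hx => ?_) fun x _ hx => ?_
      · have := b.2
        simp only [Finset.mem_range] at hx ⊢
        omega
      · rw [hA' _ _ (by simp only [Finset.mem_range] at hx; omega), mul_zero]
    rw [← h3, ← Fin.sum_univ_eq_sum_range (fun l => firstRowInv A l * A l b)] at h2
    rw [Matrix.vecMul, dotProduct, Pi.single_apply]
    simp only [Fin.ext_iff, Fin.val_zero]
    exact h2
  have h2 : v = Matrix.vecMul (Pi.single 0 1) T.adjugate := by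
    rw [← h1, Matrix.vecMul_vecMul, Matrix.mul_adjugate, det_truncation hA hA']
    simp
  have h3 := congrFun h2 (Fin.last n)
  rw [Matrix.single_one_vecMul, Matrix.row, adjugate_truncation] at h3
  simpa [hv] using h3

/-- The last column of the inverse of a truncated unitriangular matrix. -/
lemma det_mul_of_mulVec {A : Matrix ℕ ℕ ℂ} (hA : ∀ m, A m m = 1)
    (hA' : ∀ m n, n < m → A m n = 0) (n : ℕ) (c : ℕ → ℂ)
    (hc : ∀ m < n, ∑ l ∈ Finset.range (n + 1), A m l * c l = 0) :
    (-1) ^ n * (Matrix.of fun a b : Fin n => A a (b + 1)).det * c n = c 0 := by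
  set T : Matrix (Fin (n + 1)) (Fin (n + 1)) ℂ := Matrix.of fun a b => A a b with hT
  set v : Fin (n + 1) → ℂ := fun a => c a with hv
  have h1 : T.mulVec v = Pi.single (Fin.last n) (c n) := by
    funext a
    rw [Matrix.mulVec, dotProduct]
    have h2 : ∑ l : Fin (n + 1), T a l * v l = ∑ l ∈ Finset.range (n + 1), A a l * c l := by
      rw [← Fin.sum_univ_eq_sum_range (fun l => A a l * c l)]
      rfl
    rw [h2, Pi.single_apply]
    split_ifs with h
    · subst h
      rw [Finset.sum_range_succ, Finset.sum_eq_zero]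
      · simp [hA]
      · intro l hl
        rw [hA' _ _ (by simpa using hl), zero_mul]
    · refine hc _ ?_
      have := a.2
      have h' : (a : ℕ) ≠ n := fun h' => h (Fin.ext h')
      omega
  have h2 : v = T.adjugate.mulVec (Pi.single (Fin.last n) (c n)) := by
    rw [← h1, Matrix.mulVec_mulVec, Matrix.adjugate_mul, det_truncation hA hA']
    simp
  have h3 := congrFun h2 0
  rw [Matrix.mulVec_single, Pi.smul_apply, Matrix.col_apply, adjugate_truncation] at h3
  simp only [MulOpposite.smul_eq_mul_unop, MulOpposite.unop_op] at h3
  exact h3.symm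

/-! ### The matrices `M`, `N` and `H` -/

lemma matM_self (q : ℝ) (t : ℂ) (m : ℕ) : matM q t m m = 1 := by simp [matM]

lemma matM_of_lt (q : ℝ) (t : ℂ) (m n : ℕ) (h : n < m) : matM q t m n = 0 := by simp [matM, h]

/-- Translating `t` slides the matrix along its diagonal, so every row of the inverse is the first
row of the inverse at a translated argument. -/
lemma matM_add (q : ℝ) (t : ℂ) (m a b : ℕ) :
    matM q (t + m) a b = matM q t (a + m) (b + m) := by
  have h : t + (m : ℂ) + a = t + ((a + m : ℕ) : ℂ) := by push_cast; ring
  simp only [matM, qDen_eq, h, add_lt_add_iff_right, add_left_inj, Nat.add_sub_add_right]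

lemma detD_succ (q : ℝ) (n : ℕ) (t : ℂ) :
    detD q (n + 1) t = (Matrix.of fun a b : Fin n => matM q t a (b + 1)).det := rfl

lemma matMInv_eq (q : ℝ) (t : ℂ) (m l : ℕ) :
    matMInv q t m (m + l) = firstRowInv (matM q (t + m)) l := by
  rw [firstRowInv_eq_det (matM_self q _) (matM_of_lt q _), matMInv, if_neg (by omega)]
  rw [add_tsub_cancel_left, detD_succ]

lemma matMInv_triMul_matM (q : ℝ) (t : ℂ) {m n : ℕ} (h : m ≤ n) :
    triMul (matMInv q t) (matM q t) m n = if m = n then 1 else 0 := by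
  obtain ⟨d, rfl⟩ := Nat.exists_eq_add_of_le h
  have h1 := sum_firstRowInv_mul (matM_self q (t + m)) d
  rw [triMul, ← Finset.Ico_add_one_right_eq_Icc, Finset.sum_Ico_eq_sum_range,
    show m + d + 1 - m = d + 1 by omega]
  simp only [left_eq_add]
  rw [← h1]
  refine Finset.sum_congr rfl fun l _ => ?_
  rw [matMInv_eq, matM_add, add_comm l, add_comm d]

/-- The matrix of the expansion of `((q⁻ᵏ - 1) / (1 - q)) ^ (-t - m)` in powers of `qᵏ`,
up to a scalar factor. -/
def matP (q : ℝ) (t : ℂ) : Matrix ℕ ℕ ℂ := fun m n =>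
  if n < m then 0 else (1 - q) ^ m * rbinom (t + m) (n - m)

/-- With `y_k = (q⁻ᵏ - 1) / (1 - q)` one has `y_k + 1 = q y_{k+1}`; expanding `(y_k + 1) ^ (-t - m)`
in powers of `y_k` and comparing coefficients of powers of `qᵏ` suggests the identity. The proof is
the binomial theorem for `(1 - (1 - q)) ^ (n - m)`. -/
lemma sum_alternating_matP (q : ℝ) (t : ℂ) {m n : ℕ} (h : m ≤ n) :
    ∑ l ∈ Finset.Icc m n, (-1) ^ (l - m) * rbinom (t + m) (l - m) * matP q t l n =
      q ^ (n - m) * matP q t m n := by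
  obtain ⟨d, rfl⟩ := Nat.exists_eq_add_of_le h
  rw [← Finset.Ico_add_one_right_eq_Icc, Finset.sum_Ico_eq_sum_range,
    show m + d + 1 - m = d + 1 by omega, add_tsub_cancel_left]
  have h1 : ∀ l ∈ Finset.range (d + 1), (-1) ^ (m + l - m) * rbinom (t + m) (m + l - m) *
      matP q t (m + l) (m + d) =
      (-(1 - q : ℂ)) ^ l * 1 ^ (d - l) * (d.choose l : ℂ) *
        ((1 - q) ^ m * rbinom (t + m) d) := by
    intro l hl
    obtain ⟨e, rfl⟩ := Nat.exists_eq_add_of_le (Nat.lt_succ_iff.1 (Finset.mem_range.1 hl))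
    have h2 := rbinom_mul_rbinom (t + m) l e
    rw [matP, if_neg (by omega), add_tsub_cancel_left,
      show m + (l + e) - (m + l) = e by omega, one_pow, neg_pow (1 - q : ℂ), pow_add]
    push_cast
    rw [← add_assoc]
    generalize (1 - q : ℂ) = x at *
    linear_combination (-1) ^ l * x ^ m * x ^ l * h2
  rw [Finset.sum_congr rfl h1, ← Finset.sum_mul, ← add_pow, matP, if_neg (by omega),
    add_tsub_cancel_left]
  ring

lemma matN_triMul_matP (q : ℝ) (t : ℂ) {m n : ℕ} (h : m ≤ n) :
    triMul (matN q t) (matP q t) m n = q ^ (n - m) / qDen q m t * matP q t m n := by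
  rw [div_mul_eq_mul_div, ← sum_alternating_matP q t h, triMul, Finset.sum_div]
  refine Finset.sum_congr rfl fun l hl => ?_
  rw [matN, if_neg (by simp only [Finset.mem_Icc] at hl; omega), rbinom, div_mul_eq_div_div]
  ring

/-- The diagonal `1` is split as `(q ^ (-(t + m)) - 1) / q_m(t)`, so that `M` is a diagonal matrix
minus `N` and both products with `P` reduce to the same alternating sum. -/
lemma matM_eq (q : ℝ) (t : ℂ) {m : ℕ} (hm : qDen q m t ≠ 0) {n : ℕ} (h : m ≤ n) :
    matM q t m n = ((if n = m then (q : ℂ) ^ (-(t + m)) else 0) -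
      (-1) ^ (n - m) * rbinom (t + m) (n - m)) / qDen q m t := by
  rw [matM, if_neg (by omega)]
  split_ifs with h1
  · subst h1
    rw [Nat.sub_self, pow_zero, rbinom_zero, mul_one]
    exact (div_self hm).symm
  · obtain ⟨d, rfl⟩ := Nat.exists_eq_add_of_lt (lt_of_le_of_ne h (Ne.symm h1))
    rw [show m + d + 1 - m = d + 1 by omega, rbinom, div_mul_eq_div_div]
    simp only [add_tsub_cancel_right, pow_succ]
    ring

lemma matM_triMul_matP (q : ℝ) (t : ℂ) {m n : ℕ} (hm : qDen q m t ≠ 0) (h : m ≤ n) :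
    triMul (matM q t) (matP q t) m n =
      ((q : ℂ) ^ (-(t + m)) - q ^ (n - m)) / qDen q m t * matP q t m n := by
  rw [div_mul_eq_mul_div, sub_mul, ← sum_alternating_matP q t h, triMul, eq_div_iff hm,
    Finset.sum_mul]
  have h1 : ∀ l ∈ Finset.Icc m n, matM q t m l * matP q t l n * qDen q m t =
      (if l = m then (q : ℂ) ^ (-(t + m)) * matP q t l n else 0) -
        (-1) ^ (l - m) * rbinom (t + m) (l - m) * matP q t l n := by
    intro l hl
    rw [matM_eq q t hm (Finset.mem_Icc.1 hl).1, div_mul_eq_mul_div, div_mul_cancel₀ _ hm]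
    split_ifs <;> ring
  rw [Finset.sum_congr rfl h1, Finset.sum_sub_distrib, Finset.sum_ite_eq',
    if_pos (Finset.left_mem_Icc.2 h)]

lemma cpow_natCast_sub {q : ℝ} (hq0 : 0 < q) (t : ℂ) {m n : ℕ} (h : m ≤ n) :
    (q : ℂ) ^ (-(t + m)) = (q : ℂ) ^ (n - m) * (q : ℂ) ^ (-(t + n)) := by
  have hq : (q : ℂ) ≠ 0 := by exact_mod_cast hq0.ne'
  rw [← Complex.cpow_natCast, ← Complex.cpow_add _ _ hq, Nat.cast_sub h]
  congr 1
  ring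

/-- The matrix `P` diagonalizes `H`. -/
lemma matH_triMul_matP {q : ℝ} (hq0 : 0 < q) {t : ℂ} (ht : ∀ a : ℕ, expDen q (t + a) ≠ 0)
    {m n : ℕ} (h : m ≤ n) :
    triMul (matH q t) (matP q t) m n = matP q t m n / expDen q (t + n) := by
  -- Since `q ^ (-(t + l)) - q ^ (n - l) = q ^ (n - l) (q ^ (-(t + n)) - 1)`, column `n` of `N P` is
  -- column `n` of `M P` divided by a scalar independent of the row.
  have h1 : ∀ l ∈ Finset.Icc m n, matMInv q t m l * triMul (matN q t) (matP q t) l n =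
      matMInv q t m l * triMul (matM q t) (matP q t) l n / expDen q (t + n) := by
    intro l hl
    have hln := (Finset.mem_Icc.1 hl).2
    have hl0 : qDen q l t ≠ 0 := ht l
    have hn0 := ht n
    rw [matN_triMul_matP q t hln, matM_triMul_matP q t hl0 hln, cpow_natCast_sub hq0 t hln]
    rw [show (q : ℂ) ^ (n - l) * (q : ℂ) ^ (-(t + n)) - (q : ℂ) ^ (n - l) =
      (q : ℂ) ^ (n - l) * expDen q (t + n) by rw [expDen]; ring]
    field_simp
  rw [matH, triMul_assoc]
  calc ∑ l ∈ Finset.Icc m n, matMInv q t m l * triMul (matN q t) (matP q t) l n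
      = triMul (matMInv q t) (triMul (matM q t) (matP q t)) m n / expDen q (t + n) := by
        rw [Finset.sum_congr rfl h1, ← Finset.sum_div, triMul]
    _ = _ := by
        rw [← triMul_assoc]
        congr 1
        rw [triMul, Finset.sum_eq_single_of_mem m (Finset.left_mem_Icc.2 h)]
        · rw [matMInv_triMul_matM q t le_rfl, if_pos rfl, one_mul]
        · intro l hl hlm
          rw [matMInv_triMul_matM q t (Finset.mem_Icc.1 hl).1, if_neg (Ne.symm hlm), zero_mul]

/-- Column `m` of `P(-m)` is annihilated by the rows `a < m` of `M(-m)`, because `q ^ (-(t + a)) = q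
^ (m - a)` at `t = -m`. Cramer's rule then relates its top entry `(-1) ^ m` to its bottom entry `(1
- q) ^ m`. -/
lemma detD_neg_natCast {q : ℝ} (hq0 : 0 < q) (hq1 : q < 1) (m : ℕ) :
    detD q (m + 1) (-(m : ℂ)) * (1 - q) ^ m = 1 := by
  -- The bound is sharp: `q_m(-m) = 0`, but row `m` of `M(-m)` enters only through its diagonal `1`
  -- and the zeros to the left of it.
  have h1 : ∀ a < m, qDen q a (-(m : ℂ)) ≠ 0 := by
    intro a ha h
    rw [qDen, show -(-(m : ℂ) + a) = ((m - a : ℕ) : ℂ) by rw [Nat.cast_sub ha.le]; ring,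
      Complex.cpow_natCast, sub_eq_zero] at h
    have h' : q ^ (m - a) = 1 := by exact_mod_cast h
    exact absurd h' (pow_lt_one₀ hq0.le hq1 (by omega)).ne
  have h2 := det_mul_of_mulVec (matM_self q (-(m : ℂ))) (matM_of_lt q _) m
    (fun l => matP q (-(m : ℂ)) l m) (fun a ha => by
      have h3 := matM_triMul_matP q (-(m : ℂ)) (h1 a ha) ha.le
      rw [show -(-(m : ℂ) + a) = ((m - a : ℕ) : ℂ) by rw [Nat.cast_sub ha.le]; ring,
        Complex.cpow_natCast, sub_self, zero_div, zero_mul] at h3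
      rw [← h3, triMul]
      symm
      refine Finset.sum_subset (fun x hx => ?_) fun x _ hx => ?_
      · simp only [Finset.mem_range, Finset.mem_Icc] at hx ⊢
        omega
      · rw [matM_of_lt, zero_mul]
        simp only [Finset.mem_range, Finset.mem_Icc] at *
        omega)
  simp only [matP, lt_irrefl, if_false, Nat.sub_self, rbinom_zero, mul_one, Nat.not_lt_zero,
    pow_zero, one_mul, Nat.cast_zero, add_zero, Nat.sub_zero, rbinom_neg_self] at h2
  rw [mul_assoc] at h2
  have h3 := mul_left_cancel₀ (pow_ne_zero m (by norm_num : (-1 : ℂ) ≠ 0)) (h2.trans (mul_one _).symm)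
  exact h3

lemma factorial_mul_calL {q : ℝ} (hq0 : 0 < q) (hq1 : q < 1) (m : ℕ) :
    (m.factorial : ℂ) * calL q (m + 1) (-(m : ℂ)) = (-1) ^ m / (1 - q) ^ m := by
  have hq : (1 - q : ℂ) ≠ 0 := by
    rw [sub_ne_zero]
    exact_mod_cast hq1.ne'
  have h1 := Nat.cast_ne_zero (R := ℂ).mpr m.factorial_ne_zero
  rw [calL, eq_div_of_mul_eq (pow_ne_zero m hq) (detD_neg_natCast hq0 hq1 m),
    add_tsub_cancel_right, rising_neg_self]
  field_simp
  rw [← pow_mul, mul_comm, pow_mul]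
  norm_num

/-! ### Partial sums -/

/-- The partial sum `n_0 + ⋯ + n_l`. -/
def accum {A : Type*} [AddCommMonoid A] {r : ℕ} (n : Fin r → A) (l : Fin r) : A :=
  ∑ m ∈ Finset.Iic l, n m

lemma accum_eq_sum_ite {A : Type*} [AddCommMonoid A] {r : ℕ} (n : Fin r → A) (l : Fin r) :
    accum n l = ∑ m, if m ≤ l then n m else 0 := by
  rw [accum, ← Finset.sum_filter]
  congr 1
  ext
  simp

lemma accum_castAdd {A : Type*} [AddCommMonoid A] {j d : ℕ} (n : Fin (j + d) → A) (l : Fin j) :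
    accum n (Fin.castAdd d l) = accum (fun i => n (Fin.castAdd d i)) l := by
  rw [accum_eq_sum_ite, accum_eq_sum_ite, Fin.sum_univ_add]
  simp only [(Fin.strictMono_castAdd d).le_iff_le]
  rw [Finset.sum_eq_zero (s := Finset.univ (α := Fin d)), add_zero]
  intro i _
  rw [if_neg]
  simp only [Fin.le_def, Fin.val_natAdd, Fin.val_castAdd]
  omega

lemma accum_natAdd {A : Type*} [AddCommMonoid A] {j d : ℕ} (n : Fin (j + d) → A) (l : Fin d) :
    accum n (Fin.natAdd j l) =
      ∑ i, n (Fin.castAdd d i) + accum (fun i => n (Fin.natAdd j i)) l := by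
  rw [accum_eq_sum_ite, accum_eq_sum_ite, Fin.sum_univ_add]
  congr 1
  · refine Finset.sum_congr rfl fun i _ => ?_
    rw [if_pos]
    simp only [Fin.le_def, Fin.val_natAdd, Fin.val_castAdd]
    omega
  · simp

lemma accum_castSucc {A : Type*} [AddCommMonoid A] {j : ℕ} (n : Fin (j + 1) → A) (l : Fin j) :
    accum n l.castSucc = accum (fun i => n i.castSucc) l :=
  accum_castAdd n l

lemma accum_last {A : Type*} [AddCommMonoid A] {j : ℕ} (n : Fin (j + 1) → A) :
    accum n (Fin.last j) = ∑ i, n i := by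
  rw [accum]
  refine Finset.sum_congr ?_ fun _ _ => rfl
  ext i
  simpa using Fin.le_last i

lemma le_accum {r : ℕ} (n : Fin r → ℕ) (l : Fin r) : n l ≤ accum n l :=
  Finset.single_le_sum (f := n) (fun _ _ => Nat.zero_le _) (Finset.mem_Iic.2 le_rfl)

lemma psum_val_succ {r : ℕ} (s : Fin r → ℂ) (l : Fin r) : psum s ((l : ℕ) + 1) = accum s l := by
  rw [psum, accum]
  refine Finset.sum_congr ?_ fun _ _ => rfl
  ext i
  simp only [Finset.mem_filter, Finset.mem_univ, true_and, Finset.mem_Iic, Fin.le_def]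
  omega

lemma psum_zero {r : ℕ} (s : Fin r → ℂ) : psum s 0 = 0 := by simp [psum]

lemma psum_succ {r : ℕ} (s : Fin r → ℂ) (l : Fin r) :
    psum s ((l : ℕ) + 1) = psum s l + s l := by
  rw [psum, psum, show Finset.univ.filter (fun i : Fin r => (i : ℕ) < l + 1) =
    insert l (Finset.univ.filter (fun i : Fin r => (i : ℕ) < l)) by
      ext i
      simp [Fin.ext_iff]
      omega, Finset.sum_insert (by simp), add_comm]

lemma psum_self {r : ℕ} (s : Fin r → ℂ) : psum s r = ∑ i, s i := by simp [psum]

/-! ### Iterated sums with fixed total -/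

/-- The sum of `∏ a_l(n_l) ∏ b_l(n_0 + ⋯ + n_l)` over all `n_0 + ⋯ + n_i = N`, where `l ≤ i`
in the first and `l < i` in the second product. -/
def iterSum (a b : ℕ → ℕ → ℂ) : ℕ → ℕ → ℂ
  | 0, N => a 0 N
  | i + 1, N => ∑ x ∈ Finset.HasAntidiagonal.antidiagonal N,
      iterSum a b i x.1 * b i x.1 * a (i + 1) x.2

lemma sum_antidiagonalTuple_succ (i N : ℕ) (f : (Fin (i + 1) → ℕ) → ℂ) :
    ∑ n ∈ Finset.Nat.antidiagonalTuple (i + 1) N, f n =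
      ∑ x ∈ Finset.HasAntidiagonal.antidiagonal N, ∑ n ∈ Finset.Nat.antidiagonalTuple i x.1,
        f (Fin.snoc (α := fun _ => ℕ) n x.2) := by
  rw [Finset.sum_sigma']
  refine Finset.sum_bij' (fun n _ => ⟨(∑ l : Fin i, n l.castSucc, n (Fin.last i)), Fin.init n⟩)
    (fun x _ => Fin.snoc (α := fun _ => ℕ) x.2 x.1.2) ?_ ?_ ?_ ?_ ?_
  · intro n hn
    rw [Finset.Nat.mem_antidiagonalTuple, Fin.sum_univ_castSucc] at hn
    simp only [Finset.mem_sigma, Finset.HasAntidiagonal.mem_antidiagonal,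
      Finset.Nat.mem_antidiagonalTuple]
    exact ⟨hn, rfl⟩
  · intro x hx
    simp only [Finset.mem_sigma, Finset.HasAntidiagonal.mem_antidiagonal,
      Finset.Nat.mem_antidiagonalTuple] at hx
    rw [Finset.Nat.mem_antidiagonalTuple, Fin.sum_univ_castSucc]
    simp only [Fin.snoc_castSucc, Fin.snoc_last]
    rw [hx.2, hx.1]
  · intro n _
    exact Fin.snoc_init_self n
  · rintro ⟨⟨x, y⟩, n⟩ hx
    simp only [Finset.mem_sigma, Finset.Nat.mem_antidiagonalTuple] at hx
    simp only [Fin.snoc_castSucc, Fin.snoc_last, hx.2, Fin.init_snoc]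
  · intro n _
    rw [Fin.snoc_init_self]

/-- Splitting off the last entry of a tuple leaves a shorter tuple whose total is the last partial
sum seen by `b`. -/
lemma iterSum_eq (a b : ℕ → ℕ → ℂ) (i N : ℕ) :
    iterSum a b i N = ∑ n ∈ Finset.Nat.antidiagonalTuple (i + 1) N,
      (∏ l : Fin (i + 1), a l (n l)) * ∏ l : Fin i, b l (accum n l.castSucc) := by
  induction i generalizing N with
  | zero => simp [iterSum, Finset.Nat.antidiagonalTuple_one]
  | succ i ih =>
    rw [sum_antidiagonalTuple_succ, iterSum]
    refine Finset.sum_congr rfl fun x _ => ?_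
    rw [ih, Finset.sum_mul, Finset.sum_mul]
    refine Finset.sum_congr rfl fun n hn => ?_
    have h1 : ∏ l : Fin (i + 1), b l (accum (Fin.snoc (α := fun _ => ℕ) n x.2) l.castSucc) =
        (∏ l : Fin i, b l (accum n l.castSucc)) * b i x.1 := by
      simp only [accum_castSucc, Fin.snoc_castSucc]
      rw [Fin.prod_univ_castSucc]
      simp only [Fin.val_castSucc, Fin.val_last, accum_castSucc, accum_last]
      rw [Finset.Nat.mem_antidiagonalTuple.1 hn]
    rw [h1, Fin.prod_univ_castSucc (n := i + 1)]
    simp only [Fin.snoc_castSucc, Fin.snoc_last, Fin.val_castSucc, Fin.val_last]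
    ring

/-- The action of the multiplication by a power on the rows of `P`. -/
lemma sum_antidiagonal_matP_mul_rbinom (q : ℝ) (t x : ℂ) (u N : ℕ) :
    ∑ y ∈ Finset.HasAntidiagonal.antidiagonal N, matP q t u y.1 * rbinom x y.2 =
      matP q (t + x) u N := by
  by_cases h : N < u
  · rw [matP, if_pos h]
    refine Finset.sum_eq_zero fun y hy => ?_
    rw [Finset.HasAntidiagonal.mem_antidiagonal] at hy
    rw [matP, if_pos (by omega), zero_mul]
  · obtain ⟨d, rfl⟩ := Nat.exists_eq_add_of_le (not_lt.1 h)
    rw [matP, if_neg h, add_tsub_cancel_left, show t + x + (u : ℂ) = t + u + x by ring,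
      rbinom_add, Finset.mul_sum]
    symm
    refine Finset.sum_of_injOn (fun y => (u + y.1, y.2)) ?_ ?_ ?_ ?_
    · intro y _ z _ hyz
      simp only [Prod.mk.injEq] at hyz
      ext <;> omega
    · intro y hy
      simp only [Finset.mem_coe, Finset.HasAntidiagonal.mem_antidiagonal] at hy ⊢
      omega
    · intro y hy hy'
      rw [Finset.HasAntidiagonal.mem_antidiagonal] at hy
      rw [matP, if_pos, zero_mul]
      by_contra hlt
      refine hy' ⟨(y.1 - u, y.2), ?_, ?_⟩
      · simp only [Finset.mem_coe, Finset.HasAntidiagonal.mem_antidiagonal]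
        omega
      · ext <;> simp
        omega
    · intro y _
      simp only
      rw [matP, if_neg (by omega), add_tsub_cancel_left]
      ring

lemma matP_of_lt (q : ℝ) (t : ℂ) {m n : ℕ} (h : n < m) : matP q t m n = 0 := by simp [matP, h]

/-- The product `H(σ_1) ⋯ H(σ_i) P(σ_{i + 1})` in terms of iterated sums. -/
lemma sum_prodH_mul_matP {q : ℝ} (hq0 : 0 < q) {r : ℕ} (s : Fin r → ℂ) (i N : ℕ)
    (h : ∀ l < i, ∀ a : ℕ, expDen q (psum s (l + 1) + a) ≠ 0) :
    triMul (prodH q s i) (matP q (psum s (i + 1))) 0 N =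
      iterSum (fun l => rbinom (psum s (l + 1) - psum s l))
        (fun l n => 1 / expDen q (psum s (l + 1) + n)) i N := by
  induction i generalizing N with
  | zero =>
    rw [triMul, Finset.sum_eq_single_of_mem 0 (by simp)]
    · simp [prodH, iterSum, matP, psum_zero]
    · intro b _ hb
      rw [prodH, Matrix.one_apply_ne (Ne.symm hb), zero_mul]
  | succ i ih =>
    have h1 : ∀ x, iterSum (fun l => rbinom (psum s (l + 1) - psum s l))
        (fun l n => 1 / expDen q (psum s (l + 1) + n)) i x *
          (1 / expDen q (psum s (i + 1) + x)) =
        triMul (prodH q s (i + 1)) (matP q (psum s (i + 1))) 0 x := by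
      intro x
      rw [← ih _ fun l hl => h l (by omega), prodH, triMul_assoc, triMul, triMul, Finset.sum_mul]
      refine Finset.sum_congr rfl fun l hl => ?_
      rw [matH_triMul_matP hq0 (h i (by omega)) (Finset.mem_Icc.1 hl).2]
      ring
    rw [iterSum]
    simp only [h1]
    have h2 : ∀ x ∈ Finset.HasAntidiagonal.antidiagonal N,
        triMul (prodH q s (i + 1)) (matP q (psum s (i + 1))) 0 x.1 =
          ∑ u ∈ Finset.Icc 0 N, prodH q s (i + 1) 0 u * matP q (psum s (i + 1)) u x.1 := by
      intro x hx
      rw [Finset.HasAntidiagonal.mem_antidiagonal] at hx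
      refine Finset.sum_subset (fun y hy => ?_) fun y _ hy => ?_
      · simp only [Finset.mem_Icc] at hy ⊢
        omega
      · rw [matP_of_lt, mul_zero]
        simpa using hy
    rw [Finset.sum_congr rfl fun x hx => by rw [h2 x hx, Finset.sum_mul], Finset.sum_comm, triMul]
    refine Finset.sum_congr rfl fun u _ => ?_
    rw [show psum s (i + 1 + 1) = psum s (i + 1) + (psum s (i + 1 + 1) - psum s (i + 1)) by ring,
      ← sum_antidiagonal_matP_mul_rbinom, Finset.mul_sum]
    refine Finset.sum_congr rfl fun x _ => ?_
    ring_nf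

/-- The algebraic identity behind the residue formula. -/
lemma sum_calL_mul_prodH {q : ℝ} (hq0 : 0 < q) (hq1 : q < 1) {r : ℕ} (s : Fin r → ℂ) (i k : ℕ)
    (h : ∀ l < i, ∀ a : ℕ, expDen q (psum s (l + 1) + a) ≠ 0) (hk : psum s (i + 1) = -(k : ℂ))
    (c : ℂ) :
    ∑ u ∈ Finset.range (k + 1),
      -((k - u).factorial : ℂ) * calL q (k - u + 1) (-((k - u : ℕ) : ℂ)) * c *
        prodH q s i 0 u =
      -c / (1 - q) ^ k * iterSum (fun l => rbinom (psum s (l + 1) - psum s l))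
        (fun l n => 1 / expDen q (psum s (l + 1) + n)) i k := by
  have hq : (1 - q : ℂ) ≠ 0 := by
    rw [sub_ne_zero]
    exact_mod_cast hq1.ne'
  rw [← sum_prodH_mul_matP hq0 s i k h, hk, triMul, Finset.mul_sum,
    show Finset.Icc 0 k = Finset.range (k + 1) by ext; simp]
  refine Finset.sum_congr rfl fun u hu => ?_
  obtain ⟨d, rfl⟩ := Nat.exists_eq_add_of_le (Nat.lt_succ_iff.1 (Finset.mem_range.1 hu))
  rw [matP, if_neg (by omega), add_tsub_cancel_left,
    show -((u + d : ℕ) : ℂ) + u = -(d : ℂ) by push_cast; ring, rbinom_neg_self]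
  have h1 := factorial_mul_calL hq0 hq1 d
  rw [eq_div_iff (pow_ne_zero _ hq)] at h1
  rw [pow_add, div_mul_eq_mul_div, eq_div_iff (by positivity)]
  linear_combination (-c * prodH q s i 0 u * (1 - q : ℂ) ^ u) * h1

/-! ### Sums over tuples and holomorphic dependence on parameters -/

lemma summable_norm_and_hasSum_pi_prod {r : ℕ} (f : Fin r → ℕ → ℂ)
    (hf : ∀ i, Summable fun m => ‖f i m‖) :
    (Summable fun n : Fin r → ℕ => ‖∏ i, f i (n i)‖) ∧
      HasSum (fun n : Fin r → ℕ => ∏ i, f i (n i)) (∏ i, ∑' m, f i m) := by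
  induction r with
  | zero =>
    refine ⟨(hasSum_unique _).summable, ?_⟩
    simp
  | succ r ih =>
    obtain ⟨h1, h2⟩ := ih (fun i => f i.succ) fun i => hf i.succ
    have h3 : ∀ x : ℕ × (Fin r → ℕ), ∏ i, f i (Fin.consEquiv (fun _ => ℕ) x i) =
        f 0 x.1 * ∏ i : Fin r, f i.succ (x.2 i) := by
      intro x
      rw [Fin.prod_univ_succ]
      rfl
    constructor
    · rw [← (Fin.consEquiv fun _ : Fin (r + 1) => ℕ).summable_iff]
      exact ((hf 0).mul_norm h1).congr fun x => by rw [Function.comp_apply, h3]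
    · rw [← (Fin.consEquiv fun _ : Fin (r + 1) => ℕ).hasSum_iff, Fin.prod_univ_succ]
      have h4 := summable_mul_of_summable_norm
          (f := f 0) (g := fun n : Fin r → ℕ => ∏ i : Fin r, f i.succ (n i)) (hf 0) h1
      have h5 := HasSum.mul (f := f 0) (g := fun n : Fin r → ℕ => ∏ i : Fin r, f i.succ (n i))
        (Summable.of_norm (hf 0)).hasSum h2 h4
      exact h5.congr_fun h3

/-- A family of functions that are holomorphic near `z` and dominated by a summable sequence. -/
def LocDominated (g : ℕ → ℂ → ℂ) (z : ℂ) : Prop :=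
  ∃ (U : Set ℂ) (u : ℕ → ℝ), IsOpen U ∧ z ∈ U ∧ Summable u ∧
    (∀ m, DifferentiableOn ℂ (g m) U) ∧ ∀ m, ∀ w ∈ U, ‖g m w‖ ≤ u m

/-- The whole family `i ↦ g (N i) w` is packed into one function of `w` with values in the Banach
algebra `ι →ᵇ ℂ`. One-variable Weierstrass convergence makes it analytic, and analyticity survives
products and continuous functionals, which is how the several-variable series are handled. -/
lemma LocDominated.exists_analyticAt {ι : Type*} [TopologicalSpace ι] [DiscreteTopology ι]
    {g : ℕ → ℂ → ℂ} {z : ℂ} (hg : LocDominated g z) (N : ι → ℕ) :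
    ∃ B : ℂ → ι →ᵇ ℂ, AnalyticAt ℂ B z ∧ ∀ᶠ w in 𝓝 z, ∀ i, B w i = g (N i) w := by
  obtain ⟨U, u, hU, hz, hu, hd, hb⟩ := hg
  -- `χ m` is the indicator of the fibre of `N` over `m`, so at `i` the series `∑ g m w • χ m` has
  -- only the term `m = N i`.
  let χ : ℕ → ι →ᵇ ℂ := fun m => BoundedContinuousFunction.ofNormedAddCommGroupDiscrete
    (fun i => if N i = m then 1 else 0) 1 fun i => by split_ifs <;> simp
  have hχ : ∀ m, ‖χ m‖ ≤ 1 := fun m =>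
    (BoundedContinuousFunction.norm_le zero_le_one).2 fun i => by
      simp only [χ, BoundedContinuousFunction.coe_ofNormedAddCommGroupDiscrete]
      split_ifs <;> simp
  have hn : ∀ m, ∀ w ∈ U, ‖g m w • χ m‖ ≤ u m := fun m w hw => by
    rw [norm_smul]
    exact (mul_le_of_le_one_right (norm_nonneg _) (hχ m)).trans (hb m w hw)
  refine ⟨fun w => ∑' m, g m w • χ m, ?_, ?_⟩
  · exact (Complex.differentiableOn_tsum_of_summable_norm hu
      (fun m => (hd m).smul_const (χ m)) hU hn).analyticAt (hU.mem_nhds hz)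
  · filter_upwards [hU.mem_nhds hz] with w hw i
    have h1 : Summable fun m => g m w • χ m := Summable.of_norm_bounded hu fun m => hn m w hw
    have h2 := (BoundedContinuousFunction.evalCLM ℂ i).map_tsum h1
    simp only [BoundedContinuousFunction.evalCLM_apply, BoundedContinuousFunction.coe_smul] at h2
    rw [h2, tsum_eq_single (N i)]
    · simp [χ]
    · intro m hm
      simp [χ, hm.symm]

/-- Integration of a bounded function against a summable weight. -/
def weightCLM {ι : Type*} [TopologicalSpace ι] (w : ι → ℂ) (hw : Summable fun i => ‖w i‖) :
    (ι →ᵇ ℂ) →L[ℂ] ℂ :=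
  have hs : ∀ f : ι →ᵇ ℂ, Summable fun i => ‖w i * f i‖ := fun f =>
    Summable.of_nonneg_of_le (fun _ => norm_nonneg _)
      (fun i => by rw [norm_mul]; gcongr; exact f.norm_coe_le_norm i) (hw.mul_right ‖f‖)
  LinearMap.mkContinuous
    { toFun := fun f => ∑' i, w i * f i
      map_add' := fun f g => by
        rw [← (hs f).of_norm.tsum_add (hs g).of_norm]
        exact tsum_congr fun i => by simp [mul_add]
      map_smul' := fun c f => by
        rw [RingHom.id_apply, smul_eq_mul, ← tsum_mul_left]
        exact tsum_congr fun i => by simp only [BoundedContinuousFunction.coe_smul, smul_eq_mul]; ring }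
    (∑' i, ‖w i‖) fun f => by
      rw [← tsum_mul_right]
      refine (norm_tsum_le_tsum_norm (hs f)).trans ((hs f).tsum_le_tsum (fun i => ?_)
        (hw.mul_right ‖f‖))
      rw [norm_mul]
      gcongr
      exact f.norm_coe_le_norm i

lemma weightCLM_apply {ι : Type*} [TopologicalSpace ι] (w : ι → ℂ)
    (hw : Summable fun i => ‖w i‖) (f : ι →ᵇ ℂ) : weightCLM w hw f = ∑' i, w i * f i := rfl

/-- A weighted sum of products of locally dominated families depends holomorphically on the
parameters. -/
lemma analyticAt_tsum_prod {E ι L : Type*} [NormedAddCommGroup E] [NormedSpace ℂ E]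
    [TopologicalSpace ι] [DiscreteTopology ι] [Fintype L] {w : ι → ℂ}
    (hw : Summable fun i => ‖w i‖) (N : L → ι → ℕ) {g : L → ℕ → ℂ → ℂ} {a : L → E → ℂ} {p : E}
    (ha : ∀ l, AnalyticAt ℂ (a l) p) (hg : ∀ l, LocDominated (g l) (a l p)) :
    AnalyticAt ℂ (fun s => ∑' i, w i * ∏ l, g l (N l i) (a l s)) p ∧
      Summable fun i => ‖w i * ∏ l, g l (N l i) (a l p)‖ := by
  choose B hB hB' using fun l => (hg l).exists_analyticAt (N l)
  have h1 : AnalyticAt ℂ (fun s => weightCLM w hw (∏ l, B l (a l s))) p := by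
    refine ((weightCLM w hw).analyticAt _).comp_of_eq ?_ rfl
    refine Finset.analyticAt_fun_prod _ fun l _ => ?_
    exact (hB l).comp_of_eq (ha l) rfl
  have h2 : ∀ᶠ s in 𝓝 p, ∀ i, (∏ l, B l (a l s)) i = ∏ l, g l (N l i) (a l s) := by
    have h3 : ∀ᶠ s in 𝓝 p, ∀ l, ∀ i, B l (a l s) i = g l (N l i) (a l s) :=
      eventually_all.2 fun l => (ha l).continuousAt.eventually (hB' l)
    filter_upwards [h3] with s hs i
    rw [BoundedContinuousFunction.coe_prod, Finset.prod_apply]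
    exact Finset.prod_congr rfl fun l _ => hs l i
  constructor
  · refine h1.congr ?_
    filter_upwards [h2] with s hs
    rw [weightCLM_apply]
    exact tsum_congr fun i => by rw [hs i]
  · refine Summable.of_nonneg_of_le (fun _ => norm_nonneg _) (fun i => ?_)
      (hw.mul_right ‖∏ l, B l (a l p)‖)
    rw [norm_mul, ← h2.self_of_nhds i]
    gcongr
    exact BoundedContinuousFunction.norm_coe_le_norm _ i

/-! ### The binomial series -/

lemma hasSum_rbinom_mul_pow (t : ℂ) {x : ℂ} (hx : ‖x‖ < 1) :
    HasSum (fun n => rbinom t n * x ^ n) (1 / (1 - x) ^ t) := by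
  have h1 := (Complex.one_div_one_sub_cpow_hasFPowerSeriesOnBall_zero t).hasSum
    (y := x) (by
      rw [Metric.mem_eball, edist_zero_right, ← ofReal_norm]
      exact ENNReal.ofReal_lt_one.2 hx)
  simp only [zero_add, FormalMultilinearSeries.ofScalars_apply_eq, smul_eq_mul] at h1
  refine h1.congr_fun fun n => ?_
  rw [rbinom_eq_multichoose, Ring.multichoose_eq]

lemma summable_norm_rbinom_mul_pow (t : ℂ) {x : ℂ} (hx : ‖x‖ < 1) :
    Summable fun n => ‖rbinom t n * x ^ n‖ :=
  (hasSum_rbinom_mul_pow t hx).summable.norm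

/-- As a polynomial in `z`, `rbinom z n` has nonnegative coefficients, so on a disc it is dominated
by its value at the radius. -/
lemma norm_rbinom_le {z : ℂ} {R : ℝ} (h : ‖z‖ ≤ R) (n : ℕ) : ‖rbinom z n‖ ≤ ‖rbinom R n‖ := by
  rw [rbinom, rbinom, norm_div, norm_div, rising, rising, norm_prod, norm_prod]
  gcongr with i
  have hR : 0 ≤ R + i := by have := (norm_nonneg z).trans h; positivity
  calc ‖z + i‖ ≤ ‖z‖ + ‖(i : ℂ)‖ := norm_add_le _ _
    _ ≤ R + i := by simpa using h
    _ = ‖(R : ℂ) + i‖ := by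
      rw [← Complex.ofReal_natCast, ← Complex.ofReal_add, Complex.norm_real, Real.norm_of_nonneg hR]

lemma differentiable_rbinom (n : ℕ) : Differentiable ℂ fun z => rbinom z n := by
  unfold rbinom rising
  fun_prop

lemma locDominated_rbinom {x : ℂ} (hx : ‖x‖ < 1) (z : ℂ) :
    LocDominated (fun n w => rbinom w n * x ^ n) z := by
  refine ⟨Metric.ball 0 (‖z‖ + 1), fun n => ‖rbinom ((‖z‖ + 1 : ℝ) : ℂ) n * x ^ n‖,
    Metric.isOpen_ball, by simp, summable_norm_rbinom_mul_pow _ hx,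
    fun n => ((differentiable_rbinom n).mul_const _).differentiableOn, fun n w hw => ?_⟩
  simp only [norm_mul]
  gcongr
  exact norm_rbinom_le (by simpa using (mem_ball_zero_iff.1 hw).le) n

/-! ### The denominators -/

lemma norm_cpow_neg {q : ℝ} (hq0 : 0 < q) (z : ℂ) : ‖(q : ℂ) ^ (-z)‖ = q ^ (-z.re) := by
  rw [Complex.norm_cpow_eq_rpow_re_of_pos hq0, Complex.neg_re]

lemma re_eq_zero_of_expDen_eq_zero {q : ℝ} (hq0 : 0 < q) (hq1 : q < 1) {z : ℂ}
    (h : expDen q z = 0) : z.re = 0 := by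
  have h1 := norm_cpow_neg hq0 z
  rw [sub_eq_zero.1 h, norm_one] at h1
  rcases lt_trichotomy (-z.re) 0 with h2 | h2 | h2
  · exact absurd h1.symm (Real.one_lt_rpow_of_pos_of_lt_one_of_neg hq0 hq1 h2).ne'
  · exact neg_eq_zero.1 h2
  · exact absurd h1.symm (Real.rpow_lt_one hq0.le hq1 h2).ne

lemma isPole_iff {q : ℝ} (hq0 : 0 < q) (hq1 : q < 1) (z : ℂ) :
    IsPole q z ↔ ∃ a : ℕ, expDen q (z + a) = 0 := by
  have hq : (q : ℂ) ≠ 0 := by exact_mod_cast hq0.ne'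
  have hl : (Real.log q : ℂ) ≠ 0 := by exact_mod_cast (Real.log_neg hq0 hq1).ne
  rw [IsPole]
  refine exists_congr fun a => ?_
  rw [expDen, sub_eq_zero, Complex.cpow_def_of_ne_zero hq, ← Complex.ofReal_log hq0.le,
    Complex.exp_eq_one_iff]
  constructor
  · rintro ⟨b, rfl⟩
    refine ⟨-b, ?_⟩
    field_simp
    push_cast
    ring
  · rintro ⟨b, hb⟩
    refine ⟨-b, ?_⟩
    field_simp
    push_cast
    linear_combination -hb

lemma differentiable_expDen {q : ℝ} (hq0 : 0 < q) : Differentiable ℂ (expDen q) := by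
  have hq : (q : ℂ) ≠ 0 := by exact_mod_cast hq0.ne'
  exact (differentiable_neg.const_cpow (Or.inl hq)).sub_const 1

lemma differentiable_expDen_add {q : ℝ} (hq0 : 0 < q) (c : ℂ) :
    Differentiable ℂ fun z => expDen q (z + c) :=
  (differentiable_expDen hq0).comp (differentiable_id.add_const c)

/-- The quotient `(q ^ (-(z + κ)) - 1) / (q ^ (-(z + N)) - 1)`, with the value `1` for `N = κ`. -/
def denQuot (q : ℝ) (κ N : ℕ) (z : ℂ) : ℂ :=
  if N = κ then 1 else expDen q (z + κ) / expDen q (z + N)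

lemma differentiableAt_denQuot {q : ℝ} (hq0 : 0 < q) {κ N : ℕ} {z : ℂ}
    (h : N ≠ κ → expDen q (z + N) ≠ 0) : DifferentiableAt ℂ (denQuot q κ N) z := by
  unfold denQuot
  split_ifs with h1
  · exact differentiableAt_const _
  · exact (differentiable_expDen_add hq0 κ z).div (differentiable_expDen_add hq0 N z) (h h1)

lemma denQuot_eq {q : ℝ} {κ : ℕ} (N : ℕ) {z : ℂ} (h : expDen q (z + κ) ≠ 0) :
    denQuot q κ N z = expDen q (z + κ) * (1 / expDen q (z + N)) := by
  unfold denQuot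
  split_ifs with h1
  · subst h1
    exact (mul_one_div_cancel h).symm
  · ring

/-- On the unit ball about `z` one has `|q ^ (-(w + N))| ≥ q ^ (1 - Re z) / q ^ N`; once this is at
least `2`, subtracting `1` costs at most half of it. -/
lemma exists_forall_ge_norm_denQuot_le {q : ℝ} (hq0 : 0 < q) (hq1 : q < 1) (κ : ℕ) (z : ℂ) :
    ∃ (N₀ : ℕ) (C : ℝ), 0 ≤ C ∧ ∀ N, N₀ ≤ N → ∀ w ∈ Metric.ball z 1,
      expDen q (w + N) ≠ 0 ∧ ‖denQuot q κ N w‖ ≤ C * q ^ N := by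
  set c : ℝ := q ^ (1 - z.re) with hc
  have hc0 : 0 < c := Real.rpow_pos_of_pos hq0 _
  obtain ⟨N₀, hN₀⟩ : ∃ N₀ : ℕ, q ^ N₀ < c / 2 := exists_pow_lt_of_lt_one (by positivity) hq1
  have hre : ∀ w ∈ Metric.ball z 1, |w.re - z.re| < 1 := fun w hw => by
    have := (Complex.abs_re_le_norm (w - z)).trans_lt (mem_ball_iff_norm.1 hw)
    simpa using this
  have hlow : ∀ N, N₀ ≤ N → ∀ w ∈ Metric.ball z 1, c / (2 * q ^ N) ≤ ‖expDen q (w + N)‖ := by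
    intro N hN w hw
    have h1 : c / q ^ N ≤ ‖(q : ℂ) ^ (-(w + N))‖ := by
      rw [norm_cpow_neg hq0, hc, ← Real.rpow_natCast, ← Real.rpow_sub hq0]
      refine Real.rpow_le_rpow_of_exponent_ge hq0 hq1.le ?_
      have := abs_lt.1 (hre w hw)
      simp only [Complex.add_re, Complex.natCast_re]
      linarith
    have h2 : 1 ≤ c / (2 * q ^ N) := by
      have h3 : q ^ N ≤ q ^ N₀ := pow_le_pow_of_le_one hq0.le hq1.le hN
      rw [le_div_iff₀ (by positivity)]
      linarith
    have h3 := norm_sub_norm_le ((q : ℂ) ^ (-(w + N))) 1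
    rw [norm_one] at h3
    have h4 : c / q ^ N = 2 * (c / (2 * q ^ N)) := by field_simp
    rw [expDen]
    linarith
  set A : ℝ := q ^ (-z.re - 1 - κ) + 1 with hA
  have hA0 : 0 < A := by positivity
  have hup : ∀ w ∈ Metric.ball z 1, ‖expDen q (w + κ)‖ ≤ A := by
    intro w hw
    refine (norm_sub_le _ _).trans ?_
    rw [norm_one, norm_cpow_neg hq0, hA]
    gcongr ?_ + 1
    refine Real.rpow_le_rpow_of_exponent_ge hq0 hq1.le ?_
    have := abs_lt.1 (hre w hw)
    simp only [Complex.add_re, Complex.natCast_re]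
    linarith
  -- Starting beyond `κ` avoids the exceptional value `1` of `denQuot`.
  refine ⟨max N₀ (κ + 1), A * (2 / c), by positivity, fun N hN w hw => ?_⟩
  have h1 := hlow N ((le_max_left _ _).trans hN) w hw
  have h0 : 0 < c / (2 * q ^ N) := by positivity
  have hN' := (le_max_right _ _).trans hN
  refine ⟨norm_pos_iff.1 (h0.trans_le h1), ?_⟩
  rw [denQuot, if_neg (by omega), norm_div]
  calc ‖expDen q (w + κ)‖ / ‖expDen q (w + N)‖ ≤ A / (c / (2 * q ^ N)) := by
        gcongr
        exact hup w hw
    _ = A * (2 / c) * q ^ N := by field_simp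

/-- With `q = Q ^ 3` the quotients decay like `Q ^ (3 N)`. Giving away `Q ^ (2 N)` leaves a
geometric majorant for large `N`; the finitely many small `N` are bounded by continuity. -/
lemma locDominated_denQuot {Q : ℝ} (hQ0 : 0 < Q) (hQ1 : Q < 1) {κ : ℕ} {z : ℂ}
    (h : ∀ N, N ≠ κ → expDen (Q ^ 3) (z + N) ≠ 0) :
    LocDominated (fun N w => denQuot (Q ^ 3) κ N w * ((Q : ℂ) ^ (2 * N))⁻¹) z := by
  have hq0 : 0 < Q ^ 3 := by positivity
  have hq1 : Q ^ 3 < 1 := pow_lt_one₀ hQ0.le hQ1 (by norm_num)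
  obtain ⟨N₀, C, hC, hN₀⟩ := exists_forall_ge_norm_denQuot_le hq0 hq1 κ z
  have h1 : ∀ᶠ w in 𝓝 z, ∀ N ∈ Finset.range N₀, (N ≠ κ → expDen (Q ^ 3) (w + N) ≠ 0) ∧
      ‖denQuot (Q ^ 3) κ N w‖ ≤ ‖denQuot (Q ^ 3) κ N z‖ + 1 := by
    refine (Finset.eventually_all _).2 fun N _ => ?_
    refine Eventually.and ?_ ?_
    · by_cases hN : N = κ
      · exact Eventually.of_forall fun _ h' => absurd hN h'
      · filter_upwards [(differentiable_expDen_add hq0 N).continuous.continuousAt.eventually_ne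
          (h N hN)] with w hw _ using hw
    · have h2 := (differentiableAt_denQuot hq0 (h N)).continuousAt.norm
      exact (h2.eventually_lt_const (lt_add_one _)).mono fun w hw => hw.le
  obtain ⟨V, hV, hVo, hzV⟩ := eventually_nhds_iff.1 h1
  let b : ℕ → ℝ := fun N => if N ∈ Finset.range N₀ then
    (‖denQuot (Q ^ 3) κ N z‖ + 1) * (Q ^ (2 * N))⁻¹ else 0
  have hb : ∀ N, 0 ≤ b N := fun N => by
    simp only [b]
    split_ifs <;> positivity
  refine ⟨V ∩ Metric.ball z 1, fun N => b N + C * Q ^ N, hVo.inter Metric.isOpen_ball,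
    ⟨hzV, Metric.mem_ball_self one_pos⟩, ?_, fun N w hw => ?_, fun N w hw => ?_⟩
  · refine Summable.add (summable_of_ne_finset_zero (s := Finset.range N₀) fun N hN => if_neg hN) ?_
    exact (summable_geometric_of_lt_one hQ0.le hQ1).mul_left C
  · refine ((differentiableAt_denQuot hq0 fun hN => ?_).mul_const _).differentiableWithinAt
    by_cases hN' : N ∈ Finset.range N₀
    · exact (hV w hw.1 N hN').1 hN
    · exact (hN₀ N (by simpa using hN') w hw.2).1
  · have hn : ‖((Q : ℂ) ^ (2 * N))⁻¹‖ = (Q ^ (2 * N))⁻¹ := by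
      rw [norm_inv, norm_pow, Complex.norm_real, Real.norm_of_nonneg hQ0.le]
    rw [norm_mul, hn]
    by_cases hN' : N ∈ Finset.range N₀
    · refine le_trans ?_ (le_add_of_nonneg_right (by positivity))
      simp only [b, if_pos hN']
      gcongr
      exact (hV w hw.1 N hN').2
    · refine le_trans ?_ (le_add_of_nonneg_left (hb N))
      calc ‖denQuot (Q ^ 3) κ N w‖ * (Q ^ (2 * N))⁻¹
          ≤ C * (Q ^ 3) ^ N * (Q ^ (2 * N))⁻¹ := by
            gcongr
            exact (hN₀ N (by simpa using hN') w hw.2).2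
        _ = C * Q ^ N := by
            rw [← pow_mul, show 3 * N = N + 2 * N by ring, pow_add]
            field_simp

/-! ### The multiple series -/

/-- The multiple series obtained from the defining series by expanding into powers of `q` and
summing over the original indices. -/
def zetaSum (q : ℝ) {r : ℕ} (s : Fin r → ℂ) : ℂ :=
  ∑' n : Fin r → ℕ, (∏ i, rbinom (s i) (n i)) * ∏ l, (1 / expDen q (accum s l + accum n l))

/-- The continuation of the `q`-multiple zeta function. -/
def zetaCont (q : ℝ) {r : ℕ} (s : Fin r → ℂ) : ℂ := (1 - q : ℂ) ^ (psum s r) * zetaSum q s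

/-- The product of `zetaSum` and the denominators `q ^ (-(σ_l + κ_l)) - 1`. -/
def regSum (q : ℝ) {r : ℕ} (κ : Fin r → ℕ) (s : Fin r → ℂ) : ℂ :=
  ∑' n : Fin r → ℕ, (∏ i, rbinom (s i) (n i)) * ∏ l, denQuot q (κ l) (accum n l) (accum s l)

lemma regSum_eq {q : ℝ} {r : ℕ} {κ : Fin r → ℕ} {s : Fin r → ℂ}
    (h : ∀ l, expDen q (accum s l + κ l) ≠ 0) :
    regSum q κ s = (∏ l, expDen q (accum s l + κ l)) * zetaSum q s := by
  rw [regSum, zetaSum, ← tsum_mul_left]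
  refine tsum_congr fun n => ?_
  rw [Finset.prod_congr rfl fun l _ => denQuot_eq _ (h l), Finset.prod_mul_distrib]
  ring

lemma analyticAt_eval {r : ℕ} (i : Fin r) (p : Fin r → ℂ) : AnalyticAt ℂ (fun s => s i) p :=
  (ContinuousLinearMap.proj (R := ℂ) (φ := fun _ : Fin r => ℂ) i).analyticAt p

lemma analyticAt_accum {r : ℕ} (l : Fin r) (p : Fin r → ℂ) :
    AnalyticAt ℂ (fun s => accum s l) p :=
  Finset.analyticAt_fun_sum _ fun i _ => analyticAt_eval i p

lemma analyticAt_psum {r : ℕ} (j : ℕ) (p : Fin r → ℂ) : AnalyticAt ℂ (fun s => psum s j) p :=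
  Finset.analyticAt_fun_sum _ fun i _ => analyticAt_eval i p

lemma analyticAt_expDen_accum {q : ℝ} (hq0 : 0 < q) {r : ℕ} (l : Fin r) (c : ℂ) (p : Fin r → ℂ) :
    AnalyticAt ℂ (fun s => expDen q (accum s l + c)) p :=
  ((differentiable_expDen hq0).analyticAt _).comp_of_eq
    ((analyticAt_accum l p).add analyticAt_const) rfl

lemma exists_pow_three_eq {q : ℝ} (hq0 : 0 < q) (hq1 : q < 1) :
    ∃ Q : ℝ, 0 < Q ∧ Q < 1 ∧ q = Q ^ 3 := by
  refine ⟨q ^ (1 / 3 : ℝ), by positivity, Real.rpow_lt_one hq0.le hq1 (by norm_num), ?_⟩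
  rw [← Real.rpow_natCast, ← Real.rpow_mul hq0.le]
  norm_num

lemma analyticAt_regSum {q : ℝ} (hq0 : 0 < q) (hq1 : q < 1) {r : ℕ} {κ : Fin r → ℕ}
    {p : Fin r → ℂ} (h : ∀ l, ∀ N : ℕ, N ≠ κ l → expDen q (accum p l + N) ≠ 0) :
    AnalyticAt ℂ (regSum q κ) p ∧ Summable fun n : Fin r → ℕ =>
      ‖(∏ i, rbinom (p i) (n i)) * ∏ l, denQuot q (κ l) (accum n l) (accum p l)‖ := by
  obtain ⟨Q, hQ0, hQ1, rfl⟩ := exists_pow_three_eq hq0 hq1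
  have hQ : (Q : ℂ) ≠ 0 := by exact_mod_cast hQ0.ne'
  have hQn : ‖(Q : ℂ)‖ < 1 := by rwa [Complex.norm_real, Real.norm_of_nonneg hQ0.le]
  -- The factor `Q ^ (2 N_l)` given away by the quotients pays `Q ^ (n_l)` to each binomial
  -- coefficient. The rest is a summable weight, because `2 N_l - n_l ≥ n_l`.
  let w : (Fin r → ℕ) → ℂ := fun n => ∏ l, (Q : ℂ) ^ (2 * accum n l - n l)
  have hw : Summable fun n => ‖w n‖ := by
    refine Summable.of_nonneg_of_le (fun _ => norm_nonneg _) (fun n => ?_)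
      (summable_norm_and_hasSum_pi_prod (fun _ : Fin r => fun m => (Q : ℂ) ^ m) fun _ => by
        simpa using summable_geometric_of_lt_one (norm_nonneg _) hQn).1
    rw [norm_prod, norm_prod]
    gcongr with l
    rw [norm_pow, norm_pow]
    refine pow_le_pow_of_le_one (norm_nonneg _) hQn.le ?_
    have := le_accum n l
    omega
  have key := analyticAt_tsum_prod hw (L := Fin r ⊕ Fin r)
    (Sum.elim (fun i n => n i) fun l n => accum n l)
    (g := Sum.elim (fun _ m z => rbinom z m * (Q : ℂ) ^ m)
      fun l N z => denQuot (Q ^ 3) (κ l) N z * ((Q : ℂ) ^ (2 * N))⁻¹)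
    (a := Sum.elim (fun i s => s i) fun l s => accum s l) (p := p)
    (by
      rintro (i | l)
      · exact analyticAt_eval i p
      · exact analyticAt_accum l p)
    (by
      rintro (i | l)
      · exact locDominated_rbinom hQn _
      · exact locDominated_denQuot hQ0 hQ1 (h l))
  have h1 : ∀ (n : Fin r → ℕ) (s : Fin r → ℂ), (∏ i, rbinom (s i) (n i)) *
      ∏ l, denQuot (Q ^ 3) (κ l) (accum n l) (accum s l) =
      w n * ((∏ i, rbinom (s i) (n i) * (Q : ℂ) ^ n i) *
        ∏ l, denQuot (Q ^ 3) (κ l) (accum n l) (accum s l) * ((Q : ℂ) ^ (2 * accum n l))⁻¹) := by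
    intro n s
    simp only [w]
    rw [← Finset.prod_mul_distrib, ← Finset.prod_mul_distrib, ← Finset.prod_mul_distrib]
    refine Finset.prod_congr rfl fun l _ => ?_
    obtain ⟨d, hd⟩ := Nat.exists_eq_add_of_le (show n l ≤ 2 * accum n l by
      have := le_accum n l
      omega)
    rw [hd, add_tsub_cancel_left, pow_add]
    field_simp
  simp only [Fintype.prod_sum_type, Sum.elim_inl, Sum.elim_inr] at key
  constructor
  · refine key.1.congr (Eventually.of_forall fun s => ?_)
    exact tsum_congr fun n => (h1 n s).symm
  · exact key.2.congr fun n => by rw [h1]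

/-! ### The polar set -/

lemma mem_polarSet_iff {q : ℝ} (hq0 : 0 < q) (hq1 : q < 1) {r : ℕ} (s : Fin r → ℂ) :
    s ∈ polarSet q r ↔ ∃ (l : Fin r) (a : ℕ), expDen q (accum s l + a) = 0 := by
  simp only [polarSet, Set.mem_ofPred_eq, isPole_iff hq0 hq1]
  constructor
  · rintro ⟨j, hj1, hj2, a, h⟩
    refine ⟨⟨j - 1, by omega⟩, a, ?_⟩
    rw [← psum_val_succ]
    simpa [Nat.sub_add_cancel hj1] using h
  · rintro ⟨l, a, h⟩
    exact ⟨l + 1, by omega, l.2, a, by rwa [psum_val_succ]⟩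

lemma expDen_ne_zero_of_notMem {q : ℝ} (hq0 : 0 < q) (hq1 : q < 1) {r : ℕ} {s : Fin r → ℂ}
    (h : s ∉ polarSet q r) (l : Fin r) (a : ℕ) : expDen q (accum s l + a) ≠ 0 := fun h' =>
  h ((mem_polarSet_iff hq0 hq1 s).2 ⟨l, a, h'⟩)

lemma one_sub_ne_zero {q : ℝ} (hq1 : q < 1) : (1 - q : ℂ) ≠ 0 := by
  rw [sub_ne_zero]
  exact_mod_cast hq1.ne'

lemma analyticAt_one_sub_cpow_psum {q : ℝ} (hq1 : q < 1) {r : ℕ} (j : ℕ) (p : Fin r → ℂ) :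
    AnalyticAt ℂ (fun s : Fin r → ℂ => (1 - q : ℂ) ^ (psum s j)) p := by
  have h : Differentiable ℂ fun z : ℂ => (1 - q : ℂ) ^ z :=
    differentiable_id.const_cpow (Or.inl (one_sub_ne_zero hq1))
  exact (h.analyticAt _).comp_of_eq (analyticAt_psum j p) rfl

lemma zetaCont_analyticAt {q : ℝ} (hq0 : 0 < q) (hq1 : q < 1) {r : ℕ} {p : Fin r → ℂ}
    (hp : p ∉ polarSet q r) : AnalyticAt ℂ (zetaCont q) p := by
  have h0 := fun l => expDen_ne_zero_of_notMem hq0 hq1 hp l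
  have h1 : AnalyticAt ℂ (fun s : Fin r → ℂ => ∏ l, expDen q (accum s l + (0 : ℕ))) p :=
    Finset.analyticAt_fun_prod _ fun l _ => analyticAt_expDen_accum hq0 l _ p
  have h2 : ∏ l, expDen q (accum p l + (0 : ℕ)) ≠ 0 := Finset.prod_ne_zero_iff.2 fun l _ => h0 l 0
  refine ((analyticAt_one_sub_cpow_psum hq1 r p).mul ((analyticAt_regSum hq0 hq1
    (κ := fun _ => 0) fun l N _ => h0 l N).1.div h1 h2)).congr ?_
  filter_upwards [h1.continuousAt.eventually_ne h2] with s hs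
  simp only [Pi.mul_apply, Pi.div_apply]
  rw [zetaCont, regSum_eq fun l => Finset.prod_ne_zero_iff.1 hs l (Finset.mem_univ l),
    mul_div_cancel_left₀ _ hs]

/-- A zero of `expDen` has real part `0`, so for each `l` at most one shift `N` is singular at `p`.
-/
lemma exists_kappa {q : ℝ} (hq0 : 0 < q) (hq1 : q < 1) {r : ℕ} (p : Fin r → ℂ) :
    ∃ κ : Fin r → ℕ, ∀ l, ∀ N : ℕ, N ≠ κ l → expDen q (accum p l + N) ≠ 0 := by
  suffices h0 : ∀ l, ∃ κ : ℕ, ∀ N : ℕ, N ≠ κ → expDen q (accum p l + N) ≠ 0 from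
    Classical.skolem.1 h0
  intro l
  by_cases h : ∃ N : ℕ, expDen q (accum p l + N) = 0
  · obtain ⟨κ, hκ⟩ := h
    refine ⟨κ, fun N hN h' => hN ?_⟩
    have h1 := re_eq_zero_of_expDen_eq_zero hq0 hq1 hκ
    have h2 := re_eq_zero_of_expDen_eq_zero hq0 hq1 h'
    simp only [Complex.add_re, Complex.natCast_re] at h1 h2
    exact_mod_cast (by linarith : (N : ℝ) = κ)
  · push Not at h
    exact ⟨0, fun N _ => h N⟩

/-- The vector `(1, 0, …, 0)`. -/
def firstVec (r : ℕ) : Fin r → ℂ := fun i => if (i : ℕ) = 0 then 1 else 0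

lemma accum_firstVec {r : ℕ} (l : Fin r) : accum (firstVec r) l = 1 := by
  have h0 : 0 < r := l.pos
  rw [accum, Finset.sum_eq_single_of_mem (⟨0, h0⟩ : Fin r)]
  · simp [firstVec]
  · simp [Fin.le_def]
  · intro i _ hi
    rw [firstVec, if_neg fun h => hi (Fin.ext h)]

lemma accum_add_smul {r : ℕ} (p v : Fin r → ℂ) (x : ℂ) (l : Fin r) :
    accum (p + x • v) l = accum p l + x * accum v l := by
  simp [accum, Finset.sum_add_distrib, Finset.mul_sum]

/-- Moving by a real `x` along `(1, 0, …, 0)` shifts the real part of every partial sum by `x`, so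
each factor can vanish for only one `x`. -/
lemma frequently_prod_expDen_ne_zero {q : ℝ} (hq0 : 0 < q) (hq1 : q < 1) {r : ℕ}
    (κ : Fin r → ℕ) (p : Fin r → ℂ) :
    ∃ᶠ s in 𝓝 p, ∏ l, expDen q (accum s l + κ l) ≠ 0 := by
  let f : ℝ → Fin r → ℂ := fun x => p + (x : ℂ) • firstVec r
  have hf : Tendsto f (𝓝[≠] 0) (𝓝 p) := by
    have : Continuous f := by fun_prop
    have h := this.tendsto 0
    simp only [f, Complex.ofReal_zero, zero_smul, add_zero] at h
    exact h.mono_left nhdsWithin_le_nhds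
  have h1 : ∀ᶠ x : ℝ in 𝓝[≠] 0, ∀ l, x ≠ -((accum p l).re + κ l) := by
    refine eventually_all.2 fun l => ?_
    by_cases h : (0 : ℝ) = -((accum p l).re + κ l)
    · rw [← h]
      exact self_mem_nhdsWithin
    · exact eventually_ne_nhdsWithin h
  refine hf.frequently (Eventually.frequently ?_)
  filter_upwards [h1] with x hx
  refine Finset.prod_ne_zero_iff.2 fun l _ h => hx l ?_
  have h2 := re_eq_zero_of_expDen_eq_zero hq0 hq1 h
  rw [accum_add_smul, accum_firstVec] at h2
  simp only [mul_one, Complex.add_re, Complex.ofReal_re, Complex.natCast_re] at h2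
  linarith

lemma zetaCont_meromorphic {q : ℝ} (hq0 : 0 < q) (hq1 : q < 1) {r : ℕ} (p : Fin r → ℂ) :
    ∃ g h : (Fin r → ℂ) → ℂ, AnalyticAt ℂ g p ∧ AnalyticAt ℂ h p ∧
      (∃ᶠ s in 𝓝 p, h s ≠ 0) ∧ ∀ᶠ s in 𝓝 p, s ∉ polarSet q r → h s * zetaCont q s = g s := by
  obtain ⟨κ, hκ⟩ := exists_kappa hq0 hq1 p
  refine ⟨fun s => (1 - q : ℂ) ^ (psum s r) * regSum q κ s,
    fun s => ∏ l, expDen q (accum s l + κ l),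
    (analyticAt_one_sub_cpow_psum hq1 r p).mul (analyticAt_regSum hq0 hq1 hκ).1,
    Finset.analyticAt_fun_prod _ fun l _ => analyticAt_expDen_accum hq0 l _ p,
    frequently_prod_expDen_ne_zero hq0 hq1 κ p, Eventually.of_forall fun s hs => ?_⟩
  simp only
  rw [zetaCont, regSum_eq fun l => expDen_ne_zero_of_notMem hq0 hq1 hs l (κ l)]
  ring

/-! ### Uniqueness of the continuation -/

lemma countable_isPole (q : ℝ) : {z : ℂ | IsPole q z}.Countable := by
  have h := Set.countable_range fun x : ℕ × ℤ => -(x.1 : ℂ) +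
    2 * (Real.pi : ℂ) * Complex.I / (Real.log q : ℂ) * (x.2 : ℂ)
  refine h.mono ?_
  rintro z ⟨a, b, rfl⟩
  exact ⟨(a, b), rfl⟩

lemma isOpen_domU (r : ℕ) : IsOpen (domU r) := by
  have h : domU r = ⋂ l : Fin r, {s | 0 < (psum s ((l : ℕ) + 1)).re} := by
    ext s
    simp only [domU, Set.mem_ofPred_eq, Set.mem_iInter]
    refine ⟨fun h l => h _ (by omega) l.2, fun h j hj1 hj2 => ?_⟩
    have := h ⟨j - 1, by omega⟩
    simpa [Nat.sub_add_cancel hj1] using this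
  rw [h]
  refine isOpen_iInter_of_finite fun l => ?_
  refine isOpen_lt continuous_const (Complex.continuous_re.comp ?_)
  unfold psum
  fun_prop

lemma psum_firstVec {r j : ℕ} (hj1 : 1 ≤ j) (hj2 : j ≤ r) : psum (firstVec r) j = 1 := by
  have := psum_val_succ (firstVec r) ⟨j - 1, by omega⟩
  rwa [accum_firstVec, show j - 1 + 1 = j by omega] at this

/-- On the line each partial sum is affine in `z`: either injective, so that it meets the countable
set of poles countably often, or constantly equal to its value at `p`, which is not a pole. -/
lemma countable_line_polarSet (q : ℝ) {r : ℕ} {p : Fin r → ℂ} (hp : p ∉ polarSet q r) :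
    {z : ℂ | firstVec r + z • (p - firstVec r) ∈ polarSet q r}.Countable := by
  have h : {z : ℂ | firstVec r + z • (p - firstVec r) ∈ polarSet q r} ⊆
      ⋃ l : Fin r, {z : ℂ | IsPole q (accum (firstVec r + z • (p - firstVec r)) l)} := by
    rintro z ⟨j, hj1, hj2, hz⟩
    refine Set.mem_iUnion.2 ⟨⟨j - 1, by omega⟩, ?_⟩
    rw [Set.mem_ofPred_eq, ← psum_val_succ]
    simpa [Nat.sub_add_cancel hj1] using hz
  refine (Set.countable_iUnion fun l => ?_).mono h
  have hl : ∀ z : ℂ, accum (firstVec r + z • (p - firstVec r)) l = 1 + z * (accum p l - 1) := by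
    intro z
    have h2 : accum (p - firstVec r) l = accum p l - 1 := by
      rw [accum, ← accum_firstVec l, accum, accum, ← Finset.sum_sub_distrib]
      rfl
    rw [accum_add_smul, accum_firstVec, h2]
  simp only [hl]
  by_cases h1 : accum p l = 1
  · have h2 : {z : ℂ | IsPole q (1 + z * (accum p l - 1))} = ∅ := by
      ext z
      simp only [h1, sub_self, mul_zero, add_zero, Set.mem_ofPred_eq, Set.mem_empty_iff_false,
        iff_false]
      intro h'
      exact hp ⟨l + 1, by omega, l.2, by rwa [psum_val_succ, h1]⟩
    rw [h2]
    exact Set.countable_empty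
  · refine (countable_isPole q).preimage_of_injOn (f := fun z => 1 + z * (accum p l - 1)) ?_
    intro x _ y _ hxy
    exact mul_right_cancel₀ (sub_ne_zero.2 h1) (add_left_cancel hxy)

/-- The values of a continuation off the polar set are determined. -/
lemma IsContinuation.eq_of_notMem {q : ℝ} {r : ℕ} {Z W : (Fin r → ℂ) → ℂ}
    (hZ : IsContinuation q r Z) (hW : IsContinuation q r W) {p : Fin r → ℂ}
    (hp : p ∉ polarSet q r) : Z p = W p := by
  -- The line joins `p` to `(1, 0, …, 0) ∈ domU r`. A countable set does not disconnect `ℂ`, so the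
  -- one-variable identity theorem carries equality near `z = 0` to `z = 1`.
  let L : ℂ → Fin r → ℂ := fun z => firstVec r + z • (p - firstVec r)
  have hL : ∀ z, AnalyticAt ℂ L z := fun z =>
    analyticAt_const.add (analyticAt_id.smul analyticAt_const)
  have h0 : L 0 = firstVec r := by simp [L]
  have h1 : L 1 = p := by simp [L]
  have hdom : L 0 ∈ domU r := by
    rw [h0]
    intro j hj1 hj2
    rw [psum_firstVec hj1 hj2]
    exact one_pos
  have hev : ∀ᶠ z in 𝓝 (0 : ℂ), L z ∈ domU r :=
    (hL 0).continuousAt.eventually ((isOpen_domU r).mem_nhds hdom)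
  have heq : ∀ s ∈ domU r, Z s = W s := fun s hs => (hZ.hasSum s hs).unique (hW.hasSum s hs)
  set S : Set ℂ := {z | L z ∈ polarSet q r}ᶜ with hS
  have hSc : IsPreconnected S :=
    ((countable_line_polarSet q hp).isPathConnected_compl_of_one_lt_rank
      (by rw [Complex.rank_real_complex]; norm_num)).isConnected.isPreconnected
  have h0S : (0 : ℂ) ∈ S := by
    rw [hS, Set.mem_compl_iff, Set.mem_ofPred_eq, h0]
    rintro ⟨j, hj1, hj2, a, b, h⟩
    rw [psum_firstVec hj1 hj2] at h
    have h2 := congrArg Complex.re h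
    have h3 : (2 * (Real.pi : ℂ) * Complex.I / (Real.log q : ℂ) * (b : ℂ)).re = 0 := by
      rw [show 2 * (Real.pi : ℂ) * Complex.I / (Real.log q : ℂ) * (b : ℂ) =
        ((2 * Real.pi / Real.log q * b : ℝ) : ℂ) * Complex.I by push_cast; ring]
      simp
    rw [Complex.add_re, h3] at h2
    simp only [Complex.one_re, Complex.neg_re, Complex.natCast_re, add_zero] at h2
    have : (0 : ℝ) ≤ a := Nat.cast_nonneg a
    linarith
  have hf : AnalyticOnNhd ℂ (fun z => Z (L z) - W (L z)) S := fun z hz =>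
    ((hZ.analytic _ hz).comp_of_eq (hL z) rfl).sub ((hW.analytic _ hz).comp_of_eq (hL z) rfl)
  have h2 := hf.eqOn_zero_of_preconnected_of_eventuallyEq_zero hSc h0S
    (hev.mono fun z hz => by simp [heq _ hz]) (show (1 : ℂ) ∈ S by
      rw [hS, Set.mem_compl_iff, Set.mem_ofPred_eq, h1]
      exact hp)
  simp only [h1, Pi.zero_apply] at h2
  exact sub_eq_zero.1 h2

/-! ### The defining series -/

/-- The tail sums of the differences of a strictly decreasing tuple. -/
def tailSum {r : ℕ} (d : Fin r → ℕ) (j : ℕ) : ℕ :=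
  ∑ l ∈ Finset.univ.filter (fun l : Fin r => j ≤ (l : ℕ)), (d l + 1)

lemma tailSum_val {r : ℕ} (d : Fin r → ℕ) (i : Fin r) :
    tailSum d i = d i + 1 + tailSum d (i + 1) := by
  rw [tailSum, tailSum, show Finset.univ.filter (fun l : Fin r => (i : ℕ) ≤ l) =
    insert i (Finset.univ.filter (fun l : Fin r => (i : ℕ) + 1 ≤ l)) by
      ext l
      simp [Fin.ext_iff]
      omega, Finset.sum_insert (by simp)]

lemma tailSum_of_le {r : ℕ} (d : Fin r → ℕ) {j : ℕ} (h : r ≤ j) : tailSum d j = 0 := by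
  rw [tailSum, Finset.sum_eq_zero]
  intro l hl
  have := (Finset.mem_filter.1 hl).2
  omega

lemma tailSum_antitone {r : ℕ} (d : Fin r → ℕ) {i j : ℕ} (h : i ≤ j) :
    tailSum d j ≤ tailSum d i := by
  refine Finset.sum_le_sum_of_subset fun l hl => ?_
  simp only [Finset.mem_filter, Finset.mem_univ, true_and] at hl ⊢
  omega

/-- The element of the index set with given differences. -/
def toIdx {r : ℕ} (d : Fin r → ℕ) : Idx r :=
  ⟨fun i => tailSum d i, fun i j hij => by
    simp only
    rw [tailSum_val d i]
    have := tailSum_antitone d (show (i : ℕ) + 1 ≤ j from hij)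
    omega, fun i => by
    simp only
    rw [tailSum_val d i]
    omega⟩

lemma toIdx_bijective (r : ℕ) : Function.Bijective (toIdx (r := r)) := by
  constructor
  · intro d e h
    have h1 : ∀ i : Fin r, tailSum d i = tailSum e i := fun i =>
      congrFun (congrArg Subtype.val h) i
    have h2 : ∀ j : ℕ, tailSum d j = tailSum e j := fun j => by
      by_cases hj : j < r
      · exact h1 ⟨j, hj⟩
      · rw [tailSum_of_le d (by omega), tailSum_of_le e (by omega)]
    funext i
    have h3 := h2 i
    rw [tailSum_val, tailSum_val, h2 (i + 1)] at h3
    omega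
  · rintro ⟨k, hk, hk1⟩
    -- Extending `k` by `0` makes `k_r ≥ 1` one more strict descent; every gap is at least `1`,
    -- hence the `- 1` in `d`.
    let K : ℕ → ℕ := fun j => if h : j < r then k ⟨j, h⟩ else 0
    let d : Fin r → ℕ := fun l => K l - K (l + 1) - 1
    have hK : ∀ j, j < r → K (j + 1) < K j := by
      intro j hj
      simp only [K, dif_pos hj]
      split_ifs with h
      · exact hk (Fin.mk_lt_mk.2 (Nat.lt_succ_self j))
      · exact hk1 _
    have hd : ∀ m j, j + m = r → tailSum d j = K j := by
      intro m
      induction m with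
      | zero =>
        intro j hj
        rw [tailSum_of_le d (by omega)]
        simp only [K, dif_neg (show ¬ j < r by omega)]
      | succ m ih =>
        intro j hj
        have h1 := tailSum_val d ⟨j, by omega⟩
        simp only at h1
        rw [h1, ih (j + 1) (by omega)]
        have := hK j (by omega)
        simp only [d]
        omega
    refine ⟨d, Subtype.ext (funext fun i => ?_)⟩
    have h1 := hd (r - i) i (by omega)
    have h2 : K i = k i := by simp only [K, dif_pos i.2]
    exact h1.trans h2

/-- Summation by parts: it turns `∑ k_i c_i` into gaps times partial sums, so that the sum over `k`
splits into independent geometric series. -/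
lemma sum_succ_mul_accum {r : ℕ} (d : Fin r → ℕ) (c : Fin r → ℂ) :
    ∑ l, ((d l + 1 : ℕ) : ℂ) * accum c l = ∑ i, ((toIdx d).1 i : ℂ) * c i := by
  simp only [accum, toIdx, tailSum, Finset.mul_sum, Nat.cast_sum, Finset.sum_mul]
  refine Finset.sum_comm' fun x y => ?_
  simp only [Finset.mem_univ, Finset.mem_Iic, Fin.le_def, Finset.mem_filter, true_and, and_true]

lemma cpow_qNat {q : ℝ} (hq0 : 0 < q) (hq1 : q < 1) (k : ℕ) (s : ℂ) :
    (qNat q k : ℂ) ^ s = (1 - (q : ℂ) ^ k) ^ s / (1 - q : ℂ) ^ s := by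
  have h1 : 0 ≤ 1 - q ^ k := sub_nonneg.2 (pow_le_one₀ hq0.le hq1.le)
  have h2 : 0 < 1 - q := sub_pos.2 hq1
  have h3 : ((1 - q : ℝ) : ℂ) ^ s ≠ 0 := by
    rw [Complex.cpow_def_of_ne_zero (by exact_mod_cast h2.ne')]
    exact Complex.exp_ne_zero _
  have h4 := Complex.mul_cpow_ofReal_nonneg (div_nonneg h1 h2.le) h2.le s
  rw [← Complex.ofReal_mul, div_mul_cancel₀ _ h2.ne'] at h4
  rw [qNat]
  push_cast at h3 h4 ⊢
  rw [h4, mul_div_cancel_right₀ _ h3]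

lemma cpow_finsetSum {x : ℂ} (hx : x ≠ 0) {ι : Type*} (S : Finset ι) (f : ι → ℂ) :
    x ^ (∑ i ∈ S, f i) = ∏ i ∈ S, x ^ f i := by
  simp only [Complex.cpow_def_of_ne_zero hx, Finset.mul_sum, Complex.exp_sum]

lemma one_sub_cpow_psum {q : ℝ} (hq1 : q < 1) {r : ℕ} (s : Fin r → ℂ) :
    (1 - q : ℂ) ^ (psum s r) = ∏ i, (1 - q : ℂ) ^ (s i) := by
  rw [psum_self, cpow_finsetSum (one_sub_ne_zero hq1)]

lemma term_eq {q : ℝ} (hq0 : 0 < q) (hq1 : q < 1) {r : ℕ} (s : Fin r → ℂ) (k : Idx r) :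
    term q s k = (1 - q : ℂ) ^ (psum s r) * ((q : ℂ) ^ (∑ i, (k.1 i : ℂ) * s i) *
      ∏ i, (1 / (1 - (q : ℂ) ^ k.1 i) ^ (s i))) := by
  rw [term, one_sub_cpow_psum hq1, Finset.prod_congr rfl fun i _ => cpow_qNat hq0 hq1 (k.1 i) (s i),
    Finset.prod_div_distrib, Finset.prod_div_distrib, Finset.prod_const_one]
  rw [div_div_eq_mul_div]
  ring

/-- The summand of the double series. -/
def doubleTerm (q : ℝ) {r : ℕ} (s : Fin r → ℂ) (n d : Fin r → ℕ) : ℂ :=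
  (∏ i, rbinom (s i) (n i)) * ∏ l, ((q : ℂ) ^ (accum s l + accum n l)) ^ (d l + 1)

lemma natCast_accum {r : ℕ} (n : Fin r → ℕ) (l : Fin r) :
    ((accum n l : ℕ) : ℂ) = accum (fun i => (n i : ℂ)) l := by
  simp [accum]

lemma doubleTerm_eq {q : ℝ} (hq0 : 0 < q) {r : ℕ} (s : Fin r → ℂ) (n d : Fin r → ℕ) :
    doubleTerm q s n d = (q : ℂ) ^ (∑ i, ((toIdx d).1 i : ℂ) * s i) *
      ∏ i, (rbinom (s i) (n i) * ((q : ℂ) ^ (toIdx d).1 i) ^ n i) := by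
  have hq : (q : ℂ) ≠ 0 := by exact_mod_cast hq0.ne'
  have h1 : ∏ l, ((q : ℂ) ^ (accum s l + accum n l)) ^ (d l + 1) =
      (q : ℂ) ^ (∑ i, ((toIdx d).1 i : ℂ) * (s i + n i)) := by
    rw [← sum_succ_mul_accum, cpow_finsetSum hq]
    refine Finset.prod_congr rfl fun l _ => ?_
    have h2 : accum (fun i => s i + (n i : ℂ)) l = accum s l + accum n l := by
      rw [natCast_accum]
      exact Finset.sum_add_distrib
    rw [h2, Complex.cpow_nat_mul]
  have h3 : (q : ℂ) ^ (∑ i, ((toIdx d).1 i : ℂ) * n i) =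
      ∏ i, ((q : ℂ) ^ (toIdx d).1 i) ^ n i := by
    rw [cpow_finsetSum hq]
    refine Finset.prod_congr rfl fun i _ => ?_
    rw [← pow_mul, ← Complex.cpow_natCast]
    push_cast
    rfl
  rw [doubleTerm, h1, Finset.prod_mul_distrib, ← h3]
  simp only [mul_add, Finset.sum_add_distrib]
  rw [Complex.cpow_add _ _ hq]
  ring

lemma hasSum_doubleTerm_left {q : ℝ} (hq0 : 0 < q) (hq1 : q < 1) {r : ℕ} (s : Fin r → ℂ)
    (d : Fin r → ℕ) :
    HasSum (fun n => doubleTerm q s n d) ((q : ℂ) ^ (∑ i, ((toIdx d).1 i : ℂ) * s i) *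
      ∏ i, (1 / (1 - (q : ℂ) ^ (toIdx d).1 i) ^ (s i))) := by
  have h1 : ∀ i : Fin r, ‖(q : ℂ) ^ (toIdx d).1 i‖ < 1 := fun i => by
    rw [norm_pow, Complex.norm_real, Real.norm_of_nonneg hq0.le]
    have := (toIdx d).2.2 i
    exact pow_lt_one₀ hq0.le hq1 (by omega)
  have h2 := (summable_norm_and_hasSum_pi_prod
    (fun i m => rbinom (s i) m * ((q : ℂ) ^ (toIdx d).1 i) ^ m)
    fun i => summable_norm_rbinom_mul_pow _ (h1 i)).2
  rw [Finset.prod_congr rfl fun i _ => (hasSum_rbinom_mul_pow (s i) (h1 i)).tsum_eq] at h2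
  simp only [doubleTerm_eq hq0]
  exact h2.mul_left _

lemma hasSum_pow_succ {x : ℂ} (hx : ‖x‖ < 1) : HasSum (fun m : ℕ => x ^ (m + 1)) (x / (1 - x)) := by
  have := (hasSum_geometric_of_norm_lt_one hx).mul_left x
  simp only [← pow_succ'] at this
  exact this

lemma hasSum_norm_pow_succ {x : ℂ} (hx : ‖x‖ < 1) :
    HasSum (fun m : ℕ => ‖x ^ (m + 1)‖) (‖x‖ / (1 - ‖x‖)) := by
  have := (hasSum_geometric_of_lt_one (norm_nonneg x) hx).mul_left ‖x‖
  simp only [← pow_succ', ← div_eq_mul_inv] at this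
  simpa only [norm_pow] using this

lemma norm_cpow_accum {q : ℝ} (hq0 : 0 < q) {r : ℕ} (s : Fin r → ℂ) (n : Fin r → ℕ) (l : Fin r) :
    ‖(q : ℂ) ^ (accum s l + accum n l)‖ = q ^ (accum s l).re * q ^ accum n l := by
  rw [Complex.norm_cpow_eq_rpow_re_of_pos hq0, Complex.add_re, Complex.natCast_re,
    Real.rpow_add hq0, Real.rpow_natCast]

lemma re_accum_pos {r : ℕ} {s : Fin r → ℂ} (hs : s ∈ domU r) (l : Fin r) : 0 < (accum s l).re := by
  rw [← psum_val_succ]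
  exact hs _ (by omega) l.2

lemma norm_cpow_accum_lt_one {q : ℝ} (hq0 : 0 < q) (hq1 : q < 1) {r : ℕ} {s : Fin r → ℂ}
    (hs : s ∈ domU r) (n : Fin r → ℕ) (l : Fin r) :
    ‖(q : ℂ) ^ (accum s l + accum n l)‖ < 1 := by
  rw [norm_cpow_accum hq0]
  exact mul_lt_one_of_nonneg_of_lt_one_left (by positivity)
    (Real.rpow_lt_one hq0.le hq1 (re_accum_pos hs l)) (pow_le_one₀ hq0.le hq1.le)

lemma hasSum_doubleTerm_right {q : ℝ} (hq0 : 0 < q) (hq1 : q < 1) {r : ℕ} {s : Fin r → ℂ}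
    (hs : s ∈ domU r) (n : Fin r → ℕ) :
    HasSum (fun d => doubleTerm q s n d)
      ((∏ i, rbinom (s i) (n i)) * ∏ l, (1 / expDen q (accum s l + accum n l))) := by
  have h1 := norm_cpow_accum_lt_one hq0 hq1 hs n
  have h2 := (summable_norm_and_hasSum_pi_prod
    (fun l m => ((q : ℂ) ^ (accum s l + accum n l)) ^ (m + 1))
    fun l => (hasSum_norm_pow_succ (h1 l)).summable).2
  refine HasSum.mul_left _ ?_
  refine (congrArg (HasSum _) ?_).mpr h2
  refine Finset.prod_congr rfl fun l _ => ?_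
  rw [(hasSum_pow_succ (h1 l)).tsum_eq, expDen, Complex.cpow_neg]
  have hq : (q : ℂ) ≠ 0 := by exact_mod_cast hq0.ne'
  have h3 : (q : ℂ) ^ (accum s l + accum n l) ≠ 0 := by
    rw [Complex.cpow_def_of_ne_zero hq]
    exact Complex.exp_ne_zero _
  field_simp

/-- The bound uses `N_l ≥ n_l` in the numerators and `N_l ≥ 0` in the denominators; what remains is
a product of absolutely convergent binomial series at `q`. -/
lemma hasSum_norm_doubleTerm_right {q : ℝ} (hq0 : 0 < q) (hq1 : q < 1) {r : ℕ} {s : Fin r → ℂ}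
    (hs : s ∈ domU r) (n : Fin r → ℕ) :
    ∃ S : ℝ, HasSum (fun d => ‖doubleTerm q s n d‖) S ∧
      S ≤ (∏ l, q ^ (accum s l).re / (1 - q ^ (accum s l).re)) *
        ‖∏ i, rbinom (s i) (n i) * (q : ℂ) ^ n i‖ := by
  have h1 := norm_cpow_accum_lt_one hq0 hq1 hs n
  -- The real norms are cast to `ℂ` so that the complex product lemma applies.
  have h2 := (summable_norm_and_hasSum_pi_prod
    (fun l m => ((‖((q : ℂ) ^ (accum s l + accum n l)) ^ (m + 1)‖ : ℝ) : ℂ))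
    fun l => by simpa using (hasSum_norm_pow_succ (h1 l)).summable).2
  simp only [← Complex.ofReal_tsum, ← Complex.ofReal_prod] at h2
  rw [Complex.hasSum_ofReal] at h2
  simp only [(hasSum_norm_pow_succ (h1 _)).tsum_eq] at h2
  refine ⟨‖∏ i, rbinom (s i) (n i)‖ * ∏ l, ‖(q : ℂ) ^ (accum s l + accum n l)‖ /
    (1 - ‖(q : ℂ) ^ (accum s l + accum n l)‖), ?_, ?_⟩
  · have h3 := h2.mul_left ‖∏ i, rbinom (s i) (n i)‖
    simp only [doubleTerm, norm_mul, norm_prod] at h3 ⊢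
    exact h3
  · rw [mul_comm, norm_prod, norm_prod, ← Finset.prod_mul_distrib, ← Finset.prod_mul_distrib]
    refine Finset.prod_le_prod (fun l _ => ?_) fun l _ => ?_
    · have := h1 l
      have : 0 ≤ 1 - ‖(q : ℂ) ^ (accum s l + accum n l)‖ := by linarith
      positivity
    · have h3 : q ^ (accum s l).re < 1 := Real.rpow_lt_one hq0.le hq1 (re_accum_pos hs l)
      have h4 : q ^ accum n l ≤ q ^ n l := pow_le_pow_of_le_one hq0.le hq1.le (le_accum n l)
      have h5 : q ^ accum n l ≤ 1 := pow_le_one₀ hq0.le hq1.le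
      have h6 : 0 < q ^ (accum s l).re := Real.rpow_pos_of_pos hq0 _
      rw [norm_cpow_accum hq0, norm_mul, norm_pow, Complex.norm_real, Real.norm_of_nonneg hq0.le]
      calc q ^ (accum s l).re * q ^ accum n l / (1 - q ^ (accum s l).re * q ^ accum n l) *
            ‖rbinom (s l) (n l)‖
          ≤ q ^ (accum s l).re * q ^ n l / (1 - q ^ (accum s l).re) * ‖rbinom (s l) (n l)‖ := by
            gcongr
            exact mul_le_of_le_one_right h6.le h5
        _ = _ := by ring

/-- Fubini for the absolutely convergent double series: summing over `d` first gives `zetaSum`,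
summing over `n` first gives the defining series up to the factor `(1 - q) ^ σ_r`. -/
lemma zetaCont_hasSum {q : ℝ} (hq0 : 0 < q) (hq1 : q < 1) {r : ℕ} {s : Fin r → ℂ}
    (hs : s ∈ domU r) : HasSum (term q s) (zetaCont q s) := by
  have hqn : ‖(q : ℂ)‖ < 1 := by rwa [Complex.norm_real, Real.norm_of_nonneg hq0.le]
  have h1 : Summable fun x : (Fin r → ℕ) × (Fin r → ℕ) => ‖doubleTerm q s x.1 x.2‖ := by
    refine (summable_prod_of_nonneg fun _ => norm_nonneg _).2 ⟨fun n => ?_, ?_⟩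
    · obtain ⟨S, hS, -⟩ := hasSum_norm_doubleTerm_right hq0 hq1 hs n
      exact hS.summable
    · refine Summable.of_nonneg_of_le (fun n => tsum_nonneg fun _ => norm_nonneg _) (fun n => ?_)
        ((summable_norm_and_hasSum_pi_prod (fun i m => rbinom (s i) m * (q : ℂ) ^ m)
          fun i => summable_norm_rbinom_mul_pow (s i) hqn).1.mul_left
          (∏ l, q ^ (accum s l).re / (1 - q ^ (accum s l).re)))
      obtain ⟨S, hS, hS'⟩ := hasSum_norm_doubleTerm_right hq0 hq1 hs n
      rw [hS.tsum_eq]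
      exact hS'
  have h2 := h1.of_norm.hasSum
  have h3 : HasSum (fun x : (Fin r → ℕ) × (Fin r → ℕ) => doubleTerm q s x.1 x.2) (zetaSum q s) := by
    rw [zetaSum, (h2.prod_fiberwise fun n => hasSum_doubleTerm_right hq0 hq1 hs n).tsum_eq]
    exact h2
  have h4 := (((Equiv.prodComm _ _).hasSum_iff.2 h3).prod_fiberwise fun d =>
    hasSum_doubleTerm_left hq0 hq1 s d).mul_left ((1 - q : ℂ) ^ (psum s r))
  rw [← (Equiv.ofBijective _ (toIdx_bijective r)).hasSum_iff, zetaCont]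
  exact h4.congr_fun fun d => term_eq hq0 hq1 s _

theorem zetaCont_isContinuation {q : ℝ} (hq0 : 0 < q) (hq1 : q < 1) (r : ℕ) :
    IsContinuation q r (zetaCont q) where
  hasSum _ hs := zetaCont_hasSum hq0 hq1 hs
  analytic _ hs := zetaCont_analyticAt hq0 hq1 hs
  meromorphic p := zetaCont_meromorphic hq0 hq1 p

/-! ### The residues -/

lemma expDen_zero (q : ℝ) : expDen q 0 = 0 := by simp [expDen]

lemma expDen_eq_mul_dslope (q : ℝ) (z : ℂ) :
    expDen q z = z * dslope (expDen q) 0 z := by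
  have h := sub_smul_dslope (expDen q) 0 z
  rw [expDen_zero, sub_zero, sub_zero, smul_eq_mul] at h
  exact h.symm

lemma analyticAt_dslope_expDen {q : ℝ} (hq0 : 0 < q) :
    AnalyticAt ℂ (dslope (expDen q) 0) 0 := by
  obtain ⟨P, hP⟩ := (differentiable_expDen hq0).analyticAt 0
  exact ⟨_, hP.has_fpower_series_dslope_fslope⟩

lemma dslope_expDen_zero {q : ℝ} (hq0 : 0 < q) :
    dslope (expDen q) 0 0 = -(Real.log q : ℂ) := by
  have hq : (q : ℂ) ≠ 0 := by exact_mod_cast hq0.ne'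
  have h : HasDerivAt (expDen q) (-(Real.log q : ℂ)) 0 := by
    have h1 := ((hasDerivAt_neg (0 : ℂ)).const_cpow (c := (q : ℂ)) (Or.inl hq)).sub_const 1
    rw [neg_zero, Complex.cpow_zero, one_mul, mul_neg_one, ← Complex.ofReal_log hq0.le] at h1
    exact h1
  rw [dslope_same, h.deriv]

lemma psum_tail {r : ℕ} (s : Fin r → ℂ) (j m : ℕ) (hm : j + m ≤ r) :
    psum (tail s j) m = psum s (j + m) - psum s j := by
  induction m with
  | zero => simp [psum_zero]
  | succ m ih =>
    have h1 := psum_succ (tail s j) ⟨m, by omega⟩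
    have h2 := psum_succ s ⟨j + m, by omega⟩
    simp only at h1 h2
    rw [h1, ih (by omega), ← add_assoc, h2, tail]
    ring

lemma isPole_of_isPole_add_natCast {q : ℝ} {z : ℂ} {k : ℕ} (h : IsPole q (z + k)) :
    IsPole q z := by
  obtain ⟨a, b, h⟩ := h
  refine ⟨a + k, b, ?_⟩
  push_cast
  linear_combination h

lemma tail_notMem_polarSet {q : ℝ} {r j k : ℕ} {p : Fin r → ℂ} (hj : j ≤ r)
    (hp : p ∈ hyperplane r j k)
    (h : ∀ i : ℕ, 1 ≤ i → i ≤ r → i ≠ j → ¬ IsPole q (psum p i)) :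
    tail p j ∉ polarSet q (r - j) := by
  rintro ⟨m, hm1, hm2, hm⟩
  rw [psum_tail p j m (by omega), show psum p j = -(k : ℂ) from hp, sub_neg_eq_add] at hm
  exact h (j + m) (by omega) (by omega) (by omega) (isPole_of_isPole_add_natCast hm)

lemma zetaCont_congr (q : ℝ) {d e : ℕ} (h : d = e) {f : Fin d → ℂ} {g : Fin e → ℂ}
    (hfg : ∀ l, f l = g (Fin.cast h l)) : zetaCont q f = zetaCont q g := by
  subst h
  exact congrArg _ (funext hfg)

lemma accum_castAdd_last {i d : ℕ} (s : Fin (i + 1 + d) → ℂ) :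
    accum s (Fin.castAdd d (Fin.last i)) = psum s (i + 1) :=
  (psum_val_succ s (Fin.castAdd d (Fin.last i))).symm

lemma sum_castAdd_eq_psum {i d : ℕ} (s : Fin (i + 1 + d) → ℂ) :
    ∑ l, s (Fin.castAdd d l) = psum s (i + 1) := by
  rw [← accum_castAdd_last, accum_castAdd, accum_last]

/-- The sum over the first `i + 1` indices, with prescribed total `k`. -/
lemma hasSum_head (q : ℝ) {i d : ℕ} (p : Fin (i + 1 + d) → ℂ) (k : ℕ) :
    HasSum (fun n : Fin (i + 1) → ℕ => (∏ l, rbinom (p (Fin.castAdd d l)) (n l)) *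
        ((∏ l : Fin i, (1 / expDen q (accum p (Fin.castAdd d l.castSucc) +
          accum n l.castSucc))) * if ∑ l, n l = k then 1 else 0))
      (iterSum (fun l => rbinom (psum p (l + 1) - psum p l))
        (fun l n => 1 / expDen q (psum p (l + 1) + n)) i k) := by
  have h1 := hasSum_sum_of_ne_finset_zero (L := .unconditional _) (s := Finset.Nat.antidiagonalTuple (i + 1) k)
    (f := fun n : Fin (i + 1) → ℕ => (∏ l, rbinom (p (Fin.castAdd d l)) (n l)) *
        ((∏ l : Fin i, (1 / expDen q (accum p (Fin.castAdd d l.castSucc) +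
          accum n l.castSucc))) * if ∑ l, n l = k then (1 : ℂ) else 0)) (fun n hn => by
      rw [Finset.Nat.mem_antidiagonalTuple] at hn
      rw [if_neg hn, mul_zero, mul_zero])
  rw [iterSum_eq]
  convert h1 using 1
  refine Finset.sum_congr rfl fun n hn => ?_
  rw [if_pos (Finset.Nat.mem_antidiagonalTuple.1 hn), mul_one]
  congr 1
  · refine Finset.prod_congr rfl fun l _ => ?_
    have := psum_succ p (Fin.castAdd d l)
    simp only [Fin.val_castAdd] at this
    rw [this, add_sub_cancel_left]
  · refine Finset.prod_congr rfl fun l _ => ?_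
    rw [← psum_val_succ p]
    rfl

lemma summable_norm_zetaSum {q : ℝ} (hq0 : 0 < q) (hq1 : q < 1) {r : ℕ} {p : Fin r → ℂ}
    (hp : p ∉ polarSet q r) :
    Summable fun n : Fin r → ℕ =>
      ‖(∏ i, rbinom (p i) (n i)) * ∏ l, (1 / expDen q (accum p l + accum n l))‖ := by
  have h0 := fun l => expDen_ne_zero_of_notMem hq0 hq1 hp l
  have h1 := (analyticAt_regSum hq0 hq1 (κ := fun _ => 0) fun l N _ => h0 l N).2
  have h2 : ∏ l, expDen q (accum p l + (0 : ℕ)) ≠ 0 := Finset.prod_ne_zero_iff.2 fun l _ => h0 l 0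
  refine (h1.mul_left ‖(∏ l, expDen q (accum p l + (0 : ℕ)))⁻¹‖).congr fun n => ?_
  rw [Finset.prod_congr rfl fun l _ => denQuot_eq _ (h0 l 0), Finset.prod_mul_distrib, ← norm_mul]
  congr 1
  field_simp

/-- The value of the regularized series on the hyperplane. -/
lemma regSum_eq_of_mem_hyperplane {q : ℝ} (hq0 : 0 < q) (hq1 : q < 1) {i d k : ℕ}
    {κ : Fin (i + 1 + d) → ℕ} {p : Fin (i + 1 + d) → ℂ} (hp : psum p (i + 1) = -(k : ℂ))
    (hκ : ∀ l, κ l = if l = Fin.castAdd d (Fin.last i) then k else 0)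
    (h : ∀ l, l ≠ Fin.castAdd d (Fin.last i) → ∀ a : ℕ, expDen q (accum p l + a) ≠ 0)
    (ht : (fun l => p (Fin.natAdd (i + 1) l)) ∉ polarSet q d) :
    regSum q κ p = (∏ l : Fin i, expDen q (accum p (Fin.castAdd d l.castSucc))) *
      (∏ l : Fin d, expDen q (accum p (Fin.natAdd (i + 1) l))) *
      (iterSum (fun l => rbinom (psum p (l + 1) - psum p l))
        (fun l n => 1 / expDen q (psum p (l + 1) + n)) i k *
        zetaSum q fun l => p (Fin.natAdd (i + 1) l)) := by
  have hne1 : ∀ l : Fin i, Fin.castAdd d l.castSucc ≠ Fin.castAdd d (Fin.last i) := fun l hl =>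
    (Fin.castSucc_lt_last l).ne (Fin.castAdd_injective _ _ hl)
  have hne2 : ∀ l : Fin d, Fin.natAdd (i + 1) l ≠ Fin.castAdd d (Fin.last i) := fun l hl => by
    have := congrArg Fin.val hl
    simp only [Fin.val_natAdd, Fin.val_castAdd, Fin.val_last] at this
    omega
  have hA := hasSum_head q p k
  have hB := summable_norm_zetaSum hq0 hq1 ht
  have hAn := (summable_norm_iff (E := ℂ)).2 hA.summable
  rw [← hA.tsum_eq, zetaSum, tsum_mul_tsum_of_summable_norm hAn hB, ← tsum_mul_left, regSum,
    ← (Fin.appendEquiv (i + 1) d).tsum_eq]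
  refine tsum_congr fun x => ?_
  obtain ⟨n, n'⟩ := x
  have happ : Fin.appendEquiv (i + 1) d (n, n') = Fin.append n n' := rfl
  rw [happ, Fin.prod_univ_add fun l => rbinom (p l) (Fin.append n n' l),
    Fin.prod_univ_add fun l => denQuot q (κ l) (accum (Fin.append n n') l) (accum p l),
    Fin.prod_univ_castSucc fun l : Fin (i + 1) => denQuot q (κ (Fin.castAdd d l))
      (accum (Fin.append n n') (Fin.castAdd d l)) (accum p (Fin.castAdd d l))]
  simp only [Fin.append_left, Fin.append_right, accum_castAdd (Fin.append n n'),
    accum_natAdd (Fin.append n n'), accum_last]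
  have h1 : ∀ l : Fin i, denQuot q (κ (Fin.castAdd d l.castSucc)) (accum n l.castSucc)
      (accum p (Fin.castAdd d l.castSucc)) = expDen q (accum p (Fin.castAdd d l.castSucc)) *
        (1 / expDen q (accum p (Fin.castAdd d l.castSucc) + accum n l.castSucc)) := fun l => by
    have h0 := h _ (hne1 l) 0
    rw [hκ, if_neg (hne1 l), denQuot_eq _ h0, Nat.cast_zero, add_zero]
  have h2 : ∀ l : Fin d, denQuot q (κ (Fin.natAdd (i + 1) l)) (∑ m, n m + accum n' l)
      (accum p (Fin.natAdd (i + 1) l)) = expDen q (accum p (Fin.natAdd (i + 1) l)) *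
        (1 / expDen q (accum p (Fin.natAdd (i + 1) l) + (∑ m, n m + accum n' l : ℕ))) := fun l => by
    have h0 := h _ (hne2 l) 0
    rw [hκ, if_neg (hne2 l), denQuot_eq _ h0, Nat.cast_zero, add_zero]
  -- The numerator `q ^ (-(σ_j + k)) - 1` vanishes on the hyperplane, so only the exceptional value
  -- of `denQuot` survives: the quotient becomes the indicator of `N_j = k`.
  have h3 : denQuot q (κ (Fin.castAdd d (Fin.last i))) (∑ m, n m)
      (accum p (Fin.castAdd d (Fin.last i))) = if ∑ m, n m = k then 1 else 0 := by
    rw [hκ, if_pos rfl, denQuot, accum_castAdd_last, hp, neg_add_cancel, expDen_zero, zero_div]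
  simp only [h1, h2, h3, Finset.prod_mul_distrib]
  split_ifs with hk
  -- The contribution `-k` of the head to `σ_l` cancels its contribution `k` to `N_l`, which
  -- decouples head and tail.
  · have h4 : ∀ l : Fin d, accum p (Fin.natAdd (i + 1) l) + ((∑ m, n m + accum n' l : ℕ) : ℂ) =
        accum (fun l => p (Fin.natAdd (i + 1) l)) l + accum n' l := fun l => by
      rw [accum_natAdd p, sum_castAdd_eq_psum, hp, hk]
      push_cast
      ring
    simp only [h4]
    ring
  · simp

/-- Near `p` the only denominator that can vanish factors as `(σ_j + k) D(σ_j + k)` with `D(0) =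
-log q`. Cancelling the linear factor exhibits the holomorphic extension, whose value at `p` is
computed from `regSum`. -/
theorem hasResidueAlong_of_isContinuation {q : ℝ} (hq0 : 0 < q) (hq1 : q < 1) {i d k : ℕ}
    {Z : (Fin (i + 1 + d) → ℂ) → ℂ} {Z' : (Fin (i + 1 + d - (i + 1)) → ℂ) → ℂ}
    (hZ : IsContinuation q (i + 1 + d) Z) (hZ' : IsContinuation q (i + 1 + d - (i + 1)) Z') :
    HasResidueAlong q Z (i + 1) k (fun s =>
      ∑ u ∈ Finset.range (k + 1),
        -((k - u).factorial : ℂ) * calL q (k - u + 1) (-((k - u : ℕ) : ℂ)) *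
          (Z' (tail s (i + 1)) / (Real.log q : ℂ)) * prodH q s i 0 u) := by
  intro p hp hpole
  have hpk : psum p (i + 1) = -(k : ℂ) := hp
  set l₀ : Fin (i + 1 + d) := Fin.castAdd d (Fin.last i) with hl₀
  have hden : ∀ l, l ≠ l₀ → ∀ a : ℕ, expDen q (accum p l + a) ≠ 0 := by
    intro l hl a ha
    refine hpole (l + 1) (by omega) l.2 (fun h' => hl (Fin.ext ?_)) ?_
    · simpa [hl₀] using h'
    · rw [psum_val_succ]
      exact (isPole_iff hq0 hq1 _).2 ⟨a, ha⟩
  let κ : Fin (i + 1 + d) → ℕ := fun l => if l = l₀ then k else 0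
  have hκ : ∀ l, ∀ N : ℕ, N ≠ κ l → expDen q (accum p l + N) ≠ 0 := by
    intro l N hN
    by_cases hl : l = l₀
    · simp only [κ, if_pos hl] at hN
      rw [hl, accum_castAdd_last, hpk]
      intro h'
      have h1 := re_eq_zero_of_expDen_eq_zero hq0 hq1 h'
      simp only [Complex.add_re, Complex.neg_re, Complex.natCast_re] at h1
      exact hN (by exact_mod_cast (by linarith : (N : ℝ) = k))
    · exact hden l hl N
  have hne1 : ∀ l : Fin i, Fin.castAdd d l.castSucc ≠ l₀ := fun l hl =>
    (Fin.castSucc_lt_last l).ne (Fin.castAdd_injective _ _ hl)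
  have hne2 : ∀ l : Fin d, Fin.natAdd (i + 1) l ≠ l₀ := fun l hl => by
    have := congrArg Fin.val hl
    simp only [hl₀, Fin.val_natAdd, Fin.val_castAdd, Fin.val_last] at this
    omega
  let c : (Fin (i + 1 + d) → ℂ) → ℂ := fun s =>
    (∏ l : Fin i, expDen q (accum s (Fin.castAdd d l.castSucc))) *
      ∏ l : Fin d, expDen q (accum s (Fin.natAdd (i + 1) l))
  let D : ℂ → ℂ := dslope (expDen q) 0
  have hprod : ∀ s, ∏ l, expDen q (accum s l + κ l) =
      c s * ((psum s (i + 1) + k) * D (psum s (i + 1) + k)) := by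
    intro s
    have h1 : ∀ l : Fin i, κ (Fin.castAdd d l.castSucc) = 0 := fun l => if_neg (hne1 l)
    have h2 : ∀ l : Fin d, κ (Fin.natAdd (i + 1) l) = 0 := fun l => if_neg (hne2 l)
    have h3 : κ (Fin.castAdd d (Fin.last i)) = k := if_pos rfl
    rw [← expDen_eq_mul_dslope, Fin.prod_univ_add, Fin.prod_univ_castSucc]
    simp only [h1, h2, h3, Nat.cast_zero, add_zero, accum_castAdd_last, c]
    ring
  have hc : AnalyticAt ℂ c p := by
    refine (Finset.analyticAt_fun_prod _ fun l _ => ?_).mul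
      (Finset.analyticAt_fun_prod _ fun l _ => ?_) <;>
    simpa using analyticAt_expDen_accum hq0 _ 0 p
  have hcp : c p ≠ 0 := mul_ne_zero
    (Finset.prod_ne_zero_iff.2 fun l _ => by simpa using hden _ (hne1 l) 0)
    (Finset.prod_ne_zero_iff.2 fun l _ => by simpa using hden _ (hne2 l) 0)
  have hlog : (Real.log q : ℂ) ≠ 0 := by exact_mod_cast (Real.log_neg hq0 hq1).ne
  have hDp : D (psum p (i + 1) + k) = -(Real.log q : ℂ) := by
    rw [hpk, neg_add_cancel]
    exact dslope_expDen_zero hq0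
  have hD : AnalyticAt ℂ (fun s : Fin (i + 1 + d) → ℂ => D (psum s (i + 1) + k)) p :=
    (analyticAt_dslope_expDen hq0).comp_of_eq
      ((analyticAt_psum (i + 1) p).add analyticAt_const) (by rw [hpk, neg_add_cancel])
  have hreg := (analyticAt_regSum hq0 hq1 hκ).1
  refine ⟨fun s => (1 - q : ℂ) ^ (psum s (i + 1 + d)) * regSum q κ s /
      (c s * D (psum s (i + 1) + k)),
    ((analyticAt_one_sub_cpow_psum hq1 _ p).mul hreg).div (hc.mul hD)
      (mul_ne_zero hcp (by rw [hDp]; exact neg_ne_zero.2 hlog)), ?_, ?_⟩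
  · refine Eventually.of_forall fun s hs => ?_
    have h0 := fun l => expDen_ne_zero_of_notMem hq0 hq1 hs l (κ l)
    have h1 : c s * ((psum s (i + 1) + k) * D (psum s (i + 1) + k)) ≠ 0 := by
      rw [← hprod]
      exact Finset.prod_ne_zero_iff.2 fun l _ => h0 l
    have h2 : c s * D (psum s (i + 1) + k) ≠ 0 := fun h' => h1 (by
      linear_combination (psum s (i + 1) + k) * h')
    simp only
    rw [hZ.eq_of_notMem (zetaCont_isContinuation hq0 hq1 _) hs, zetaCont, regSum_eq h0, hprod,
      div_eq_iff h2]
    ring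
  · have htail := tail_notMem_polarSet (by omega) hp hpole
    have hd : i + 1 + d - (i + 1) = d := by omega
    have htail' : zetaCont q (tail p (i + 1)) =
        zetaCont q (fun l => p (Fin.natAdd (i + 1) l)) :=
      -- `i + 1 + d - (i + 1)` and `d` are equal but not definitionally so, hence the transport
      -- between the two forms of the tail.
      zetaCont_congr q hd fun l => rfl
    have ht : (fun l => p (Fin.natAdd (i + 1) l)) ∉ polarSet q d := by
      rw [mem_polarSet_iff hq0 hq1]
      rintro ⟨l, a, h⟩
      refine hden _ (hne2 l) (k + a) ?_
      rw [accum_natAdd, sum_castAdd_eq_psum, hpk, ← h]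
      congr 1
      push_cast
      ring
    have hsum : psum p (i + 1 + d) =
        -(k : ℂ) + psum (fun l => p (Fin.natAdd (i + 1) l)) d := by
      rw [psum_self, psum_self, Fin.sum_univ_add, sum_castAdd_eq_psum, hpk]
    simp only
    rw [sum_calL_mul_prodH hq0 hq1 p i k (fun l hl a => by
      have h1 := hden _ (hne1 ⟨l, hl⟩) a
      rwa [← psum_val_succ] at h1) hpk,
      hZ'.eq_of_notMem (zetaCont_isContinuation hq0 hq1 _) htail, htail', zetaCont,
      regSum_eq_of_mem_hyperplane hq0 hq1 hpk (fun l => rfl) hden ht, hDp, hsum,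
      Complex.cpow_add _ _ (one_sub_ne_zero hq1), Complex.cpow_neg, Complex.cpow_natCast]
    have h3 := pow_ne_zero k (one_sub_ne_zero hq1)
    change _ * (c p * _) / _ = _
    field_simp

end QMZV

end

theorem mainTheorem5 (q : ℝ) (hq0 : 0 < q) (hq1 : q < 1) :
    (∀ r : ℕ, ∃ Z : (Fin r → ℂ) → ℂ, QMZV.IsContinuation q r Z) ∧
    ∀ (r j k : ℕ), 2 ≤ j → j ≤ r →
      ∀ (Z : (Fin r → ℂ) → ℂ) (Z' : (Fin (r - j) → ℂ) → ℂ),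
        QMZV.IsContinuation q r Z → QMZV.IsContinuation q (r - j) Z' →
        QMZV.HasResidueAlong q Z j k (fun s =>
          ∑ u ∈ Finset.range (k + 1),
            -((k - u).factorial : ℂ) * QMZV.calL q (k - u + 1) (-((k - u : ℕ) : ℂ)) *
              (Z' (QMZV.tail s j) / (Real.log q : ℂ)) *
              QMZV.prodH q s (j - 1) 0 u) := by
  refine ⟨fun r => ⟨_, QMZV.zetaCont_isContinuation hq0 hq1 r⟩, ?_⟩
  intro r j k hj hjr Z Z' hZ hZ'
  obtain ⟨i, rfl⟩ : ∃ i, j = i + 1 := ⟨j - 1, by omega⟩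
  obtain ⟨d, rfl⟩ := Nat.exists_eq_add_of_le hjr
  exact QMZV.hasResidueAlong_of_isContinuation hq0 hq1 hZ hZ'
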